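/- Let $\mathbb{k}$ be a field, let $m,n\ge 1$, let $K_{m,n}$ be the complete bipartite graph with partite sets $X_1,\dots,X_m$ and $Y_1,\dots,Y_n$, and let $\omega$ assign a positive integer weight $\omega(X_iY_j)$ to each edge. Put $S=\mathbb{k}[X_1,\dots,X_m,Y_1,\dots,Y_n]$, let $I(K_{m,n}^\omega)\subseteq S$ be the ideal generated by the monomials $f_{i,j}=(X_iY_j)^{\omega(X_iY_j)}$, and let $\alpha=\min_{i,j}\omega(X_iY_j)$. Visscher's cell complex $V_{m,n}$ is the product of two simplices with vertex sets $[m]$ and $[n]$: its cells are the empty cell and the pairs $(A,B)$ with $\emptyset\ne A\subseteq[m]$, $\emptyset\ne B\subseteq[n]$, of dimension $|A|+|B|-2$. The cell $(A,B)$ is labelled by $f_{A,B}=\operatorname{lcm}(f_{i,j}\mid i\in A,\ j\in B)$. The complex $F^\omega_{m,n}$ of free $S$-modules has the basis $1$ in degree $0$ and, in degree $d\ge1$, the basis $[A,B]$ with $A,B\neq\emptyset$ and $|A|+|B|=d+1$. Its differential sends $[\{i\},\{j\}]$ to $f_{i,j}$ and, for $A=\{a_1<\dots<a_s\}$ and $B=\{b_1<\dots<b_t\}$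 with $s+t\ge3$, $$[A,B]\mapsto\sum_{i=1}^s(-1)^{i-1}\frac{f_{A,B}}{f_{A\setminus a_i,B}}[A\setminus a_i,B]+\sum_{j=1}^t(-1)^{s+j-1}\frac{f_{A,B}}{f_{A,B\setminus b_j}}[A,B\setminus b_j],$$ where terms with an empty first or second entry are omitted. Visscher's construction for $K_{m,n}^\omega-v$, where $v$ is a vertex and $m,n\ge2$, is the same construction for the remaining edge-weighted complete bipartite graph over the polynomial ring in the remaining vertices. Then $F^\omega_{m,n}$ is a cellular minimal free resolution of $S/I(K^\omega_{m,n})$ if and only if one of the following conditions holds: 1. $m=1$ or $n=1$; 2. $m,n\ge2$ and there is a vertex $v$ of $K_{m,n}$ such that $\omega(vw)=\alpha$ for all vertices $w$ adjacent to $v$, and Visscher's construction for $K_{m,n}^\omega-v$ yields a cellular minimal free resolution of the quotient by the edge ideal of $K_{m,n}^\omega-v$. -/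

import Mathlib

/-! ### Finite regular cell complexes, incidence functions and cellular free complexes

Cells are indexed by a type `C`; `deg c` is the dimension of the cell `c` plus one, so that the empty
cell has degree `0`, vertices have degree `1`, and `deg` is also the homological degree of the
corresponding basis vector. -/

/-- The sets `cell c`, `c : C`, are the open cells of a finite regular cell complex structure on `X`,
the cell `c` having dimension `deg c - 1` (with one empty cell, of dimension `-1`). -/
structure IsFiniteRegularCellComplex {X : Type*} [TopologicalSpace X] {C : Type*}
    (deg : C → ℕ) (cell : C → Set X) : Prop where
  nonempty_space : Nonempty X
  hausdorff : T2Space X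
  finite_cells : Finite C
  pairwise_disjoint : Pairwise fun c c' => Disjoint (cell c) (cell c')
  iUnion_eq : ⋃ c, cell c = Set.univ
  unique_empty_cell : ∃! c, deg c = 0
  cell_eq_empty_iff : ∀ c, cell c = ∅ ↔ deg c = 0
  /-- The closure of a `d`-dimensional cell is homeomorphic to the closed unit ball of `ℝ^d`, and the
  open cell corresponds to the open ball. -/
  closed_ball : ∀ c d, deg c = d + 1 →
    ∃ h : Metric.closedBall (0 : EuclideanSpace ℝ (Fin d)) 1 ≃ₜ closure (cell c),
      ∀ x, (h x : X) ∈ cell c ↔ ‖(x : EuclideanSpace ℝ (Fin d))‖ < 1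
  /-- The boundary of a cell lies in the union of the cells of smaller dimension. -/
  boundary : ∀ c, closure (cell c) \ cell c ⊆ ⋃ c' ∈ {c' | deg c' < deg c}, cell c'

/-- `ε` is an incidence function on the cell complex (only its values on pairs of cells whose
dimensions differ by one matter). A cell `c'` is a face of `c` when `cell c' ⊆ closure (cell c)`. -/
structure IsIncidenceFunction {X : Type*} [TopologicalSpace X] {C : Type*}
    (deg : C → ℕ) (cell : C → Set X) (ε : C → C → ℤ) : Prop where
  values : ∀ c c', deg c = deg c' + 1 → ε c c' = 0 ∨ ε c c' = 1 ∨ ε c c' = -1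
  ne_zero_iff : ∀ c c', deg c = deg c' + 1 → (ε c c' ≠ 0 ↔ cell c' ⊆ closure (cell c))
  empty_cell : ∀ v e, deg v = 1 → deg e = 0 → ε v e = 1
  cancel : ∀ c c₁ c₂ e, deg c = deg e + 2 → deg c₁ = deg e + 1 → deg c₂ = deg e + 1 → c₁ ≠ c₂ →
    cell c₁ ⊆ closure (cell c) → cell c₂ ⊆ closure (cell c) →
    cell e ⊆ closure (cell c₁) → cell e ⊆ closure (cell c₂) →
    ε c c₁ * ε c₁ e + ε c c₂ * ε c₂ e = 0

/-- `ℓ` labels every cell by (the exponent vector of) the least common multiple of the labels of its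
vertices. Divisibility of monomials is the order on exponent vectors. -/
def IsMonomialLabelling {X : Type*} [TopologicalSpace X] {C σ : Type*}
    (deg : C → ℕ) (cell : C → Set X) (ℓ : C → (σ →₀ ℕ)) : Prop :=
  ∀ c, IsLUB {e | ∃ v, deg v = 1 ∧ cell v ⊆ closure (cell c) ∧ e = ℓ v} (ℓ c)

/-- The free module in homological degree `d` of the cellular complex: its basis is the set of cells
of dimension `d - 1`. -/
abbrev CellularModule (k : Type*) [Field k] (σ : Type*) {C : Type*} (deg : C → ℕ) (d : ℕ) :=
  {c : C // deg c = d} →₀ MvPolynomial σ k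

/-- The differential of the cellular complex, from degree `d + 1` to degree `d`: it sends the basis
vector of `c` to the sum of the `ε c c' • (ℓ c / ℓ c')` times the basis vector of `c'`. -/
noncomputable def cellularDifferential (k : Type*) [Field k] {σ C : Type*} [Fintype C]
    (deg : C → ℕ) (ε : C → C → ℤ) (ℓ : C → (σ →₀ ℕ)) (d : ℕ) :
    CellularModule k σ deg (d + 1) →ₗ[MvPolynomial σ k] CellularModule k σ deg d :=
  Finsupp.linearCombination (MvPolynomial σ k) fun c : {c : C // deg c = d + 1} =>
    ∑ c' : {c : C // deg c = d},
      Finsupp.single c' (MvPolynomial.monomial (ℓ c - ℓ c') ((ε c c' : ℤ) : k))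

/-- The augmentation from degree `0` of the cellular complex to `S ⧸ I`, sending the basis vector of
the empty cell to `1`. -/
noncomputable def cellularAugmentation (k : Type*) [Field k] {σ C : Type*} (deg : C → ℕ)
    (I : Ideal (MvPolynomial σ k)) :
    CellularModule k σ deg 0 →ₗ[MvPolynomial σ k] (MvPolynomial σ k ⧸ I) :=
  Finsupp.linearCombination (MvPolynomial σ k) fun _ => (1 : MvPolynomial σ k ⧸ I)

/-- The cellular complex of the labelled cell complex `(cell, ℓ)` with incidence function `ε` is a
(cellular) minimal free resolution of `S ⧸ I`, where `S = k[σ]`. -/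
structure IsCellularMinimalFreeResolution (k : Type*) [Field k] {X : Type*} [TopologicalSpace X]
    {σ C : Type*} [Fintype C] (deg : C → ℕ) (cell : C → Set X) (ε : C → C → ℤ)
    (ℓ : C → (σ →₀ ℕ)) (I : Ideal (MvPolynomial σ k)) : Prop where
  regular : IsFiniteRegularCellComplex deg cell
  incidence : IsIncidenceFunction deg cell ε
  labelling : IsMonomialLabelling deg cell ℓ
  /-- Minimality: the image of every differential lies in `(X_s : s ∈ σ) F`. -/
  minimal : ∀ d, LinearMap.range (cellularDifferential k deg ε ℓ d) ≤
    Ideal.span (Set.range (MvPolynomial.X : σ → MvPolynomial σ k)) •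
      (⊤ : Submodule (MvPolynomial σ k) (CellularModule k σ deg d))
  exact : ∀ d, Function.Exact (cellularDifferential k deg ε ℓ (d + 1))
    (cellularDifferential k deg ε ℓ d)
  exact_augmentation : Function.Exact (cellularDifferential k deg ε ℓ 0)
    (cellularAugmentation k deg I)
  surjective_augmentation : Function.Surjective (cellularAugmentation k deg I)

/-! ### Visscher's construction

The partite sets of the complete bipartite graph are `{X_i : i ∈ ι}` and `{Y_j : j ∈ κ}`; an
edge-weighting is a function `ω : ι → κ → ℕ` with positive values, `ω i j` being the weight of the
edge `X_i Y_j`. In `MvPolynomial (ι ⊕ κ) k` the variable `X_i` is `Sum.inl i` and `Y_j` is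
`Sum.inr j`. -/

/-- The cells of Visscher's complex: the pairs `(A, B)` of nonempty subsets of `ι` and `κ`, together
with the empty cell `(∅, ∅)`. -/
abbrev VisscherCell (ι κ : Type*) :=
  {c : Finset ι × Finset κ // c.1 = ∅ ↔ c.2 = ∅}

/-- The homological degree `|A| + |B| - 1` of `(A, B)`, i.e. the dimension `|A| + |B| - 2` plus one;
by truncated subtraction the empty cell has degree `0`. -/
def visscherDegree {ι κ : Type*} (c : VisscherCell ι κ) : ℕ :=
  c.1.1.card + c.1.2.card - 1

/-- The geometric realization of Visscher's complex is the product of two simplices, with vertex sets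
`ι` and `κ`; the open cell `(A, B)` is the product of the relative interiors of the faces `A` and
`B`. -/
def visscherRealization {ι κ : Type*} [Fintype ι] [Fintype κ] (c : VisscherCell ι κ) :
    Set (stdSimplex ℝ ι × stdSimplex ℝ κ) :=
  {p | (∀ i, p.1.1 i ≠ 0 ↔ i ∈ c.1.1) ∧ (∀ j, p.2.1 j ≠ 0 ↔ j ∈ c.1.2)}

/-- The signs of Visscher's differential. With `A = {a_1 < ⋯ < a_s}` and `B = {b_1 < ⋯ < b_t}`, the
sign of `(A - a_i, B)` in `(A, B)` is `(-1)^(i-1)`, that of `(A, B - b_j)` is `(-1)^(s+j-1)`, and that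
of the empty cell in a vertex is `1`. -/
def visscherSign {ι κ : Type*} [LinearOrder ι] [LinearOrder κ] (c c' : VisscherCell ι κ) : ℤ :=
  if c'.1.1 = ∅ then 1
  else (∑ a ∈ c.1.1, if c'.1 = (c.1.1.erase a, c.1.2)
      then (-1) ^ (c.1.1.filter (· < a)).card else 0) +
    ∑ b ∈ c.1.2, if c'.1 = (c.1.1, c.1.2.erase b)
      then (-1) ^ (c.1.1.card + (c.1.2.filter (· < b)).card) else 0

/-- The exponent vector of `(X_i Y_j)^(ω i j)`. -/
noncomputable def edgeExponent {ι κ : Type*} (ω : ι → κ → ℕ) (i : ι) (j : κ) : ι ⊕ κ →₀ ℕ :=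
  ω i j • (Finsupp.single (Sum.inl i) 1 + Finsupp.single (Sum.inr j) 1)

theorem monomial_edgeExponent (k : Type*) [Field k] {ι κ : Type*} (ω : ι → κ → ℕ) (i : ι) (j : κ) :
    MvPolynomial.monomial (edgeExponent ω i j) (1 : k) =
      (MvPolynomial.X (Sum.inl i) * MvPolynomial.X (Sum.inr j)) ^ ω i j := by
  simp [edgeExponent, MvPolynomial.X, MvPolynomial.monomial_mul, MvPolynomial.monomial_pow]

/-- The label of `(A, B)`: the exponent vector of `lcm ((X_i Y_j)^(ω i j) : i ∈ A, j ∈ B)`. -/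
noncomputable def visscherLabel {ι κ : Type*} (ω : ι → κ → ℕ) (c : VisscherCell ι κ) :
    ι ⊕ κ →₀ ℕ :=
  (c.1.1 ×ˢ c.1.2).sup fun p => edgeExponent ω p.1 p.2

/-- The edge ideal of the edge-weighted complete bipartite graph. -/
noncomputable def weightedEdgeIdeal (k : Type*) [Field k] {ι κ : Type*} (ω : ι → κ → ℕ) :
    Ideal (MvPolynomial (ι ⊕ κ) k) :=
  Ideal.span (Set.range fun p : ι × κ =>
    (MvPolynomial.X (Sum.inl p.1) * MvPolynomial.X (Sum.inr p.2)) ^ ω p.1 p.2)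

/-- Visscher's complex, labelled through the edge-weighting `ω`, is a cellular minimal free resolution
of the quotient of the polynomial ring by the edge ideal of the edge-weighted complete bipartite
graph. -/
def VisscherResolves (k : Type*) [Field k] {ι κ : Type*} [Fintype ι] [Fintype κ]
    [LinearOrder ι] [LinearOrder κ] (ω : ι → κ → ℕ) : Prop :=
  IsCellularMinimalFreeResolution k (visscherDegree (ι := ι) (κ := κ)) visscherRealization
    visscherSign (visscherLabel ω) (weightedEdgeIdeal k ω)

/-!
As the weights are positive, the label of the cell `(A, B)` determines `A` and `B`, so the complex
is always minimal (`range_visscherDifferential_le`), and the product of two simplices is always a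
regular cell complex with incidence function `visscherSign`; what depends on `ω` is exactness. It
may be tested degree by degree (`exact_cellularDifferential_iff`): in multidegree `X^a Y^b` the
complex is the chain complex of the cells `(A, B)` for which `A × B` is contained in the bipartite
graph `G` of the edges `i j` with `ω i j ≤ a i` and `ω i j ≤ b j`. So Visscher's complex is a
resolution if and only if all these complexes of bicliques are acyclic (`visscherResolves_iff`).

Two facts about complexes of bicliques give the sufficiency of the conditions. If a vertex `v` is
adjacent in `G` to all the vertices on the other side that are not isolated, then the complex
collapses onto the full simplex of the cells `({v}, B)` and is acyclic
(`acyclicOn_isBiclique_of_dominating`). Deleting isolated vertices does not change the complex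
(`acyclicOn_isBiclique_restrict_iff`). If one side has a single vertex, the first fact always
applies. If all edges at `v` have the minimal weight `α`, then either the exponent at `v` is at
least `α` and `v` is adjacent to all non-isolated vertices of the other side, or `v` is isolated
and may be deleted.

Conversely, extending exponents by zero from the vertices of a complete bipartite subgraph shows
that exactness for the whole graph implies exactness for the subgraph
(`VisscherResolves.restrict`). For the existence of `v`, take an edge `i j` of weight `α`. If
`i j'` and `i' j` both had larger weight, then in the multidegree of the least common multiple of the
monomials of `i j` and `i' j'` the graph `G` would consist of two disjoint edges, and its complex
of bicliques would be disconnected. Hence `i` or `j` is the vertex sought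
(`VisscherResolves.forall_eq_or_forall_eq`).
-/

/-! ### Acyclicity of based complexes -/

section Acyclic

open Finset

theorem Fintype.sum_subtype_eq_sum_of_support {C M : Type*} [Fintype C] [AddCommMonoid M]
    {p : C → Prop} [DecidablePred p] (f : C → M) (hf : ∀ c, f c ≠ 0 → p c) :
    ∑ c : {c // p c}, f c = ∑ c, f c := by
  classical
  rw [← Finset.sum_subtype (univ.filter p) (by simp) f]
  exact Finset.sum_subset (subset_univ _) fun c _ hc => by
    by_contra h; exact hc (by simpa using hf c h)

/-- The chain complex over `k` spanned by the cells that satisfy `P`, with boundary coefficients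
`ε`, has no reduced homology in homological degree at least `1`. Chains are functions `g : C → k`
with the appropriate support. -/
def AcyclicOn {k C : Type*} [Field k] [Fintype C] (deg : C → ℕ) (ε : C → C → k) (P : C → Prop) :
    Prop :=
  ∀ (d : ℕ) (g : C → k), (∀ c, g c ≠ 0 → deg c = d + 1 ∧ P c) →
    (∀ e, deg e = d → ∑ c, g c * ε c e = 0) →
    ∃ h : C → k, (∀ c, h c ≠ 0 → deg c = d + 2 ∧ P c) ∧
      ∀ e, deg e = d + 1 → ∑ c, h c * ε c e = g e

/-- The boundary coefficients `ε` square to zero. The intermediate cells are restricted to the right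
degree because the values of `ε` on other pairs of cells carry no meaning. -/
def SquaresToZero {k C : Type*} [Field k] [Fintype C] (deg : C → ℕ) (ε : C → C → k) : Prop :=
  ∀ c e, deg c = deg e + 2 → ∑ c₁, (if deg c₁ = deg e + 1 then ε c c₁ * ε c₁ e else 0) = 0

variable {k C : Type*} [Field k] [Fintype C] {deg : C → ℕ} {ε : C → C → k}

theorem SquaresToZero.boundary_boundary (hε : SquaresToZero deg ε) {d : ℕ} {h : C → k}
    (hh : ∀ c, h c ≠ 0 → deg c = d + 2) {e : C} (he : deg e = d) {g : C → k}
    (hg : ∀ c, g c ≠ 0 → deg c = d + 1)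
    (hgh : ∀ c, deg c = d + 1 → g c = ∑ c', h c' * ε c' c) :
    ∑ c, g c * ε c e = 0 := by
  have h1 : ∀ c, g c * ε c e
      = ∑ c', h c' * (if deg c = deg e + 1 then ε c' c * ε c e else 0) := by
    intro c
    by_cases hc : deg c = d + 1
    · rw [hgh c hc, Finset.sum_mul]
      exact Finset.sum_congr rfl fun c' _ => by rw [if_pos (by omega), mul_assoc]
    · have : g c = 0 := by by_contra h0; exact hc (hg c h0)
      simp [this, show ¬ deg c = deg e + 1 by omega]
  simp_rw [h1]
  rw [Finset.sum_comm]
  refine Finset.sum_eq_zero fun c' _ => ?_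
  rw [← Finset.mul_sum]
  by_cases h0 : h c' = 0
  · simp [h0]
  · rw [hε c' e (by rw [hh c' h0, he]), mul_zero]

/-- Reduction along a matching. Let `R` be a subcomplex in which every cell `c` with `Q c` is a face
of exactly one cell `t c` without the property `Q`, and `t` is injective. Then every cycle of `R` is
homologous to a cycle supported on the cells that are neither `Q` nor of the form `t c`. -/
theorem SquaresToZero.exists_matching_reduction (hε : SquaresToZero deg ε) {R Q : C → Prop}
    (t : C → C)
    (ht : ∀ c, R c → Q c → R (t c) ∧ ¬ Q (t c) ∧ deg (t c) = deg c + 1)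
    (hinj : ∀ c c', R c → Q c → R c' → Q c' → t c = t c' → c = c')
    (hmatch : ∀ c c', R c → R c' → Q c → ¬ Q c' → deg c' = deg c + 1 →
      (ε c' c ≠ 0 ↔ c' = t c))
    (hface : ∀ c c', R c → deg c = deg c' + 1 → ε c c' ≠ 0 → R c')
    {d : ℕ} {g : C → k} (hg : ∀ c, g c ≠ 0 → deg c = d + 1 ∧ R c)
    (hcycle : ∀ e, deg e = d → ∑ c, g c * ε c e = 0) :
    ∃ h g' : C → k, (∀ c, h c ≠ 0 → deg c = d + 2 ∧ R c) ∧
      (∀ c, g' c ≠ 0 → deg c = d + 1 ∧ R c ∧ ¬ Q c ∧ ∀ c₀, R c₀ → Q c₀ → c ≠ t c₀) ∧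
      (∀ e, deg e = d → ∑ c, g' c * ε c e = 0) ∧
      ∀ e, deg e = d + 1 → g e = g' e + ∑ c, h c * ε c e := by
  classical
  -- `h` is the chain whose boundary agrees with `g` on the cells with the property `Q`.
  set h : C → k := fun c' => ∑ c, if Q c ∧ t c = c' then g c / ε c' c else 0 with hh
  have hsupp : ∀ c', h c' ≠ 0 → deg c' = d + 2 ∧ R c' ∧ ¬ Q c' := by
    intro c' hc'
    obtain ⟨c, -, hc⟩ := Finset.exists_ne_zero_of_sum_ne_zero hc'
    by_cases hQ : Q c ∧ t c = c'
    · rw [if_pos hQ] at hc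
      have hgc : g c ≠ 0 := by rintro h0; simp [h0] at hc
      obtain ⟨h1, h2, h3⟩ := ht c (hg c hgc).2 hQ.1
      rw [hQ.2] at h1 h2 h3
      exact ⟨by rw [h3, (hg c hgc).1], h1, h2⟩
    · simp [hQ] at hc
  have hbd : ∀ e, deg e = d + 1 → R e → Q e → ∑ c', h c' * ε c' e = g e := by
    intro e he hRe hQe
    obtain ⟨h1, h2, h3⟩ := ht e hRe hQe
    have hne : ε (t e) e ≠ 0 := (hmatch e (t e) hRe h1 hQe h2 h3).2 rfl
    rw [Finset.sum_eq_single (t e)]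
    · have : h (t e) = g e / ε (t e) e := by
        rw [hh]
        simp only
        rw [Finset.sum_eq_single e]
        · simp [hQe]
        · intro c _ hce
          by_cases hQ : Q c ∧ t c = t e
          · rw [if_pos hQ]
            by_cases h0 : g c = 0
            · simp [h0]
            · exact absurd (hinj c e (hg c h0).2 hQ.1 hRe hQe hQ.2) hce
          · rw [if_neg hQ]
        · simp
      rw [this, div_mul_cancel₀ _ hne]
    · intro c' _ hc'
      by_cases h0 : h c' = 0
      · simp [h0]
      · obtain ⟨k1, k2, k3⟩ := hsupp c' h0
        have : ¬ ε c' e ≠ 0 := fun hc =>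
          hc' ((hmatch e c' hRe k2 hQe k3 (by omega)).1 hc)
        simp [not_not.1 this]
    · simp
  set g' : C → k := fun e => if deg e = d + 1 then g e - ∑ c, h c * ε c e else 0 with hg'
  have hg'1 : ∀ e, g' e ≠ 0 → deg e = d + 1 ∧ R e ∧ ¬ Q e := by
    intro e he
    have hd : deg e = d + 1 := by by_contra hd; simp [hg', hd] at he
    have hR : R e := by
      by_contra hR
      apply he
      have hge : g e = 0 := by by_contra h0; exact hR (hg e h0).2
      have : ∑ c, h c * ε c e = 0 := Finset.sum_eq_zero fun c _ => by
        by_contra h0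
        exact hR (hface c e (hsupp c (left_ne_zero_of_mul h0)).2.1
          (by rw [(hsupp c (left_ne_zero_of_mul h0)).1, hd]) (right_ne_zero_of_mul h0))
      simp [hg', hge, this]
    refine ⟨hd, hR, fun hQ => he ?_⟩
    simp [hg', hd, hbd e hd hR hQ]
  have hg'cycle : ∀ e, deg e = d → ∑ c, g' c * ε c e = 0 := by
    intro e he
    have h2 := hε.boundary_boundary (fun c hc => (hsupp c hc).1) he
      (g := fun e => if deg e = d + 1 then ∑ c, h c * ε c e else 0)
      (fun c hc => by by_contra h0; simp [h0] at hc) (fun c hc => by simp [hc])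
    have hsplit : ∑ c, g' c * ε c e = ∑ c, g c * ε c e -
        ∑ c, (if deg c = d + 1 then ∑ c₁, h c₁ * ε c₁ c else 0) * ε c e := by
      rw [← Finset.sum_sub_distrib]
      refine Finset.sum_congr rfl fun c _ => ?_
      by_cases hc : deg c = d + 1
      · simp [hg', hc, sub_mul]
      · have : g c = 0 := by by_contra h0; exact hc (hg c h0).1
        simp [hg', hc, this]
    rw [hsplit, hcycle e he, h2, sub_zero]
  refine ⟨h, g', fun c hc => ⟨(hsupp c hc).1, (hsupp c hc).2.1⟩, fun c hc => ?_, hg'cycle,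
    fun e he => by simp [hg', he]⟩
  obtain ⟨k1, k2, k3⟩ := hg'1 c hc
  refine ⟨k1, k2, k3, ?_⟩
  rintro c₀ hR hQ rfl
  -- `t c₀` is the only cell in the support of `g'` that has `c₀` as a face, so its coefficient is
  -- determined by the coefficient `0` of the boundary at `c₀`.
  obtain ⟨h1, h2, h3⟩ := ht c₀ hR hQ
  have hne : ε (t c₀) c₀ ≠ 0 := (hmatch c₀ (t c₀) hR h1 hQ h2 h3).2 rfl
  have hz := hg'cycle c₀ (by omega)
  rw [Finset.sum_eq_single (t c₀)] at hz
  · exact (mul_ne_zero hc hne) hz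
  · intro c' _ hc'
    by_contra h0
    obtain ⟨l1, l2, l3⟩ := hg'1 c' (left_ne_zero_of_mul h0)
    exact hc' ((hmatch c₀ c' hR l2 hQ l3 (by omega)).1 (right_ne_zero_of_mul h0))
  · simp

/-- Acyclicity only depends on the cells that satisfy `P`: it may be tested after pulling back along
an injection of cells whose range contains the subcomplex. -/
theorem acyclicOn_comp_iff {C' : Type*} [Fintype C'] {P : C → Prop} {deg' : C' → ℕ}
    {ε' : C' → C' → k} (f : C' → C) (hf : Function.Injective f) (hdeg : ∀ c, deg (f c) = deg' c)
    (hεf : ∀ c c', ε (f c) (f c') = ε' c c') (hrange : ∀ c, P c → ∃ c', f c' = c)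
    (hface : ∀ c c', P c → deg c = deg c' + 1 → ε c c' ≠ 0 → P c') :
    AcyclicOn deg' ε' (fun c => P (f c)) ↔ AcyclicOn deg ε P := by
  classical
  have hsum : ∀ (F : C → k), (∀ c, F c ≠ 0 → P c) → ∀ e,
      ∑ c, F c * ε c (f e) = ∑ c, F (f c) * ε' c e := by
    intro F hF e
    refine (Fintype.sum_of_injective f hf _ _ (fun c hc => ?_) fun c => by rw [hεf]).symm
    by_contra h0
    exact hc (hrange c (hF c (left_ne_zero_of_mul h0)))
  have hext : ∀ (F : C' → k) (c : C), Function.extend f F (0 : C → k) c ≠ 0 →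
      ∃ c', f c' = c ∧ F c' ≠ 0 := by
    intro F c hc
    by_cases h : ∃ c', f c' = c
    · obtain ⟨c', rfl⟩ := h
      exact ⟨c', rfl, by rwa [hf.extend_apply] at hc⟩
    · exact absurd (Function.extend_apply' F (0 : C → k) c h) hc
  -- Outside the range of `f`, boundaries of chains of the subcomplex vanish.
  have hout : ∀ (F : C → k) (d : ℕ), (∀ c, F c ≠ 0 → deg c = d + 1 ∧ P c) → ∀ e, deg e = d →
      (¬ ∃ e', f e' = e) → ∑ c, F c * ε c e = 0 := by
    intro F d hF e he hne
    refine Finset.sum_eq_zero fun c _ => ?_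
    by_contra h0
    obtain ⟨h1, h2⟩ := hF c (left_ne_zero_of_mul h0)
    exact hne (hrange e (hface c e h2 (by omega) (right_ne_zero_of_mul h0)))
  constructor
  · intro H d g hg hcycle
    obtain ⟨h, hh, hgh⟩ := H d (fun c => g (f c))
      (fun c hc => ⟨by rw [← hdeg, (hg _ hc).1], (hg _ hc).2⟩)
      (fun e he => by rw [← hsum g (fun c hc => (hg c hc).2), hcycle _ (by rw [hdeg, he])])
    have hsupp : ∀ c, Function.extend f h 0 c ≠ 0 → deg c = d + 2 ∧ P c := by
      intro c hc
      obtain ⟨c', rfl, hc'⟩ := hext h c hc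
      exact ⟨by rw [hdeg, (hh c' hc').1], (hh c' hc').2⟩
    refine ⟨Function.extend f h 0, hsupp, fun e he => ?_⟩
    by_cases hr : ∃ e', f e' = e
    · obtain ⟨e', rfl⟩ := hr
      rw [hsum _ (fun c hc => (hsupp c hc).2), ← hgh e' (by rw [← hdeg, he])]
      simp [hf.extend_apply]
    · rw [hout _ (d + 1) hsupp e he hr]
      by_contra h0
      exact hr (hrange e (hg e (Ne.symm h0)).2)
  · intro H d g hg hcycle
    have hsupp : ∀ c, Function.extend f g 0 c ≠ 0 → deg c = d + 1 ∧ P c := by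
      intro c hc
      obtain ⟨c', rfl, hc'⟩ := hext g c hc
      exact ⟨by rw [hdeg, (hg c' hc').1], (hg c' hc').2⟩
    obtain ⟨h, hh, hgh⟩ := H d (Function.extend f g 0) hsupp (fun e he => by
      by_cases hr : ∃ e', f e' = e
      · obtain ⟨e', rfl⟩ := hr
        rw [hsum _ (fun c hc => (hsupp c hc).2), ← hcycle e' (by rw [← hdeg, he])]
        simp [hf.extend_apply]
      · exact hout _ d hsupp e he hr)
    refine ⟨fun c => h (f c), fun c hc => ⟨by rw [← hdeg, (hh _ hc).1], (hh _ hc).2⟩,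
      fun e he => ?_⟩
    rw [← hsum h (fun c hc => (hh c hc).2), hgh _ (by rw [hdeg, he]), hf.extend_apply]

end Acyclic

/-! ### Multigraded strands of a cellular complex -/

section Strands

open MvPolynomial

variable {k : Type*} [Field k] {σ C : Type*} {deg : C → ℕ} {ε : C → C → ℤ} {ℓ : C → (σ →₀ ℕ)}

/-- The coefficients of the component of multidegree `u` of `z`, as a function on all cells. -/
noncomputable def strandCoeff (ℓ : C → (σ →₀ ℕ)) {deg : C → ℕ} {d : ℕ} (u : σ →₀ ℕ)
    (z : CellularModule k σ deg d) (c : C) : k :=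
  open Classical in
  if h : deg c = d ∧ ℓ c ≤ u then coeff (u - ℓ c) (z ⟨c, h.1⟩) else 0

theorem strandCoeff_support {d : ℕ} {u : σ →₀ ℕ} {z : CellularModule k σ deg d} {c : C}
    (hc : strandCoeff ℓ u z c ≠ 0) : deg c = d ∧ ℓ c ≤ u := by
  classical
  by_contra h
  exact hc (dif_neg h)

variable [Fintype C]

theorem cellularDifferential_apply (d : ℕ) (z : CellularModule k σ deg (d + 1))
    (c' : {c : C // deg c = d}) :
    cellularDifferential k deg ε ℓ d z c' =
      ∑ c : {c : C // deg c = d + 1}, z c * monomial (ℓ c - ℓ c') ((ε c c' : ℤ) : k) := by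
  classical
  rw [cellularDifferential, Finsupp.linearCombination_apply, Finsupp.sum_fintype _ _ (by simp),
    Finsupp.finsetSum_apply]
  refine Finset.sum_congr rfl fun c _ => ?_
  rw [Finsupp.smul_apply, Finsupp.finsetSum_apply, smul_eq_mul]
  simp [Finsupp.single_apply]

/-- The homogeneous element of multidegree `u` with coefficients `g`; the coefficients at cells
whose label does not divide the monomial of exponent `u` are ignored. -/
noncomputable def strandElement (ℓ : C → (σ →₀ ℕ)) (deg : C → ℕ) (d : ℕ) (u : σ →₀ ℕ) (g : C → k) :
    CellularModule k σ deg d :=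
  open Classical in
  Finsupp.equivFunOnFinite.symm fun c => if ℓ c ≤ u then monomial (u - ℓ c) (g c) else 0

theorem strandElement_apply (d : ℕ) (u : σ →₀ ℕ) (g : C → k) (c : {c : C // deg c = d})
    (hg : g c ≠ 0 → ℓ c ≤ u) :
    strandElement ℓ deg d u g c = monomial (u - ℓ c) (g c) := by
  classical
  by_cases h : ℓ c ≤ u
  · simp [strandElement, h]
  · have : g c = 0 := by by_contra h0; exact h (hg h0)
    simp [strandElement, h, this]

theorem strandCoeff_strandElement {d : ℕ} {u : σ →₀ ℕ} {g : C → k}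
    (hg : ∀ c, g c ≠ 0 → deg c = d ∧ ℓ c ≤ u) :
    strandCoeff ℓ u (strandElement ℓ deg d u g) = g := by
  classical
  funext c
  by_cases h : deg c = d ∧ ℓ c ≤ u
  · rw [strandCoeff, dif_pos h, strandElement_apply _ _ _ _ fun _ => h.2]
    simp
  · rw [strandCoeff, dif_neg h]
    by_contra h0
    exact h (hg c (Ne.symm h0))

theorem cellularDifferential_strandElement
    (hmono : ∀ c c', deg c = deg c' + 1 → ((ε c c' : ℤ) : k) ≠ 0 → ℓ c' ≤ ℓ c)
    {d : ℕ} {u : σ →₀ ℕ} {g : C → k} (hg : ∀ c, g c ≠ 0 → deg c = d + 1 ∧ ℓ c ≤ u)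
    {g' : C → k} (hg' : ∀ e, deg e = d → g' e = ∑ c, g c * ((ε c e : ℤ) : k)) :
    cellularDifferential k deg ε ℓ d (strandElement ℓ deg (d + 1) u g) =
      strandElement ℓ deg d u g' := by
  classical
  have hsupp : ∀ (e : C), deg e = d → g' e ≠ 0 → ℓ e ≤ u := by
    intro e he h0
    rw [hg' e he] at h0
    obtain ⟨c, -, hc⟩ := Finset.exists_ne_zero_of_sum_ne_zero h0
    obtain ⟨h1, h2⟩ := hg c (left_ne_zero_of_mul hc)
    exact (hmono c e (by omega) (right_ne_zero_of_mul hc)).trans h2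
  refine Finsupp.ext fun e => ?_
  rw [cellularDifferential_apply, strandElement_apply _ _ _ _ (hsupp e e.2), hg' e e.2, map_sum,
    ← Fintype.sum_subtype_eq_sum_of_support (p := fun c => deg c = d + 1)
      (fun c => monomial (u - ℓ e) (g c * ((ε c e : ℤ) : k)))]
  · refine Finset.sum_congr rfl fun c _ => ?_
    rw [strandElement_apply _ _ _ _ fun h => (hg c h).2, monomial_mul]
    by_cases h0 : g c = 0
    · simp [h0]
    by_cases h1 : ((ε c e : ℤ) : k) = 0
    · simp [h1]
    congr 2
    have h2 := (hg c h0).2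
    have h3 := hmono c e (by rw [c.2, e.2]) h1
    exact tsub_add_tsub_cancel h2 h3
  · intro c hc
    refine (hg c fun h0 => hc ?_).1
    simp [h0]

theorem strandCoeff_cellularDifferential
    (hmono : ∀ c c', deg c = deg c' + 1 → ((ε c c' : ℤ) : k) ≠ 0 → ℓ c' ≤ ℓ c)
    {d : ℕ} (u : σ →₀ ℕ) (z : CellularModule k σ deg (d + 1)) (e : C) (he : deg e = d) :
    strandCoeff ℓ u (cellularDifferential k deg ε ℓ d z) e =
      ∑ c, strandCoeff ℓ u z c * ((ε c e : ℤ) : k) := by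
  classical
  by_cases heu : ℓ e ≤ u
  · rw [strandCoeff, dif_pos ⟨he, heu⟩, cellularDifferential_apply, coeff_sum,
      ← Fintype.sum_subtype_eq_sum_of_support (p := fun c => deg c = d + 1)
        (fun c => strandCoeff ℓ u z c * ((ε c e : ℤ) : k))
        fun c hc => (strandCoeff_support (left_ne_zero_of_mul hc)).1]
    refine Finset.sum_congr rfl fun c _ => ?_
    rw [coeff_mul_monomial']
    by_cases h1 : ((ε c e : ℤ) : k) = 0
    · simp [h1]
    have h3 := hmono c e (by rw [c.2, he]) h1
    by_cases hc : ℓ c ≤ u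
    · rw [if_pos (tsub_le_tsub_right hc _), strandCoeff, dif_pos ⟨c.2, hc⟩,
        tsub_tsub_tsub_cancel_right h3]
    · rw [if_neg, strandCoeff, dif_neg fun h => hc h.2, zero_mul]
      intro h
      exact hc (by simpa [tsub_add_cancel_of_le h3, tsub_add_cancel_of_le heu] using
        add_le_add_left h (ℓ e))
  · rw [strandCoeff, dif_neg fun h => heu h.2]
    refine (Finset.sum_eq_zero fun c _ => ?_).symm
    by_contra h0
    obtain ⟨h1, h2⟩ := strandCoeff_support (left_ne_zero_of_mul h0)
    exact heu ((hmono c e (by omega) (right_ne_zero_of_mul h0)).trans h2)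

/-- Every element is the sum of its homogeneous components. -/
theorem exists_eq_sum_strandElement {d : ℕ} (z : CellularModule k σ deg d) :
    ∃ U : Finset (σ →₀ ℕ), z = ∑ u ∈ U, strandElement ℓ deg d u (strandCoeff ℓ u z) := by
  classical
  refine ⟨Finset.univ.biUnion fun c : {c : C // deg c = d} => (z c).support.image (· + ℓ c), ?_⟩
  refine Finsupp.ext fun c => ?_
  rw [Finsupp.finsetSum_apply]
  refine MvPolynomial.ext _ _ fun s => ?_
  rw [coeff_sum]
  have hterm : ∀ u, coeff s (strandElement ℓ deg d u (strandCoeff ℓ u z) c) =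
      if u = s + ℓ c then coeff s (z c) else 0 := by
    intro u
    rw [strandElement_apply _ _ _ _ fun h => (strandCoeff_support h).2, coeff_monomial]
    by_cases hu : ℓ c ≤ u
    · rw [strandCoeff, dif_pos ⟨c.2, hu⟩]
      by_cases hs : u - ℓ c = s
      · rw [if_pos hs, if_pos (by rw [← hs, tsub_add_cancel_of_le hu]), hs]
      · rw [if_neg hs, if_neg]
        rintro rfl
        exact hs (by simp)
    · rw [strandCoeff, dif_neg fun h => hu h.2, ite_self,
        if_neg fun h => hu (by rw [h]; simp)]
  simp_rw [hterm]
  rw [Finset.sum_ite_eq']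
  split_ifs with h
  · rfl
  · by_contra h0
    exact h (Finset.mem_biUnion.2 ⟨c, Finset.mem_univ _, Finset.mem_image.2
      ⟨s, mem_support_iff.2 h0, rfl⟩⟩)

/-- Exactness of the cellular complex in positive degrees may be tested on its multigraded strands,
i.e. on the subcomplexes of the cells whose label divides a given monomial. -/
theorem exact_cellularDifferential_iff
    (hmono : ∀ c c', deg c = deg c' + 1 → ((ε c c' : ℤ) : k) ≠ 0 → ℓ c' ≤ ℓ c)
    (hsq : SquaresToZero deg fun c c' => ((ε c c' : ℤ) : k)) :
    (∀ d, Function.Exact (cellularDifferential k deg ε ℓ (d + 1))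
      (cellularDifferential k deg ε ℓ d)) ↔
    ∀ u : σ →₀ ℕ, AcyclicOn deg (fun c c' => ((ε c c' : ℤ) : k)) fun c => ℓ c ≤ u := by
  have hcycle : ∀ {d : ℕ} (z : CellularModule k σ deg (d + 1)),
      cellularDifferential k deg ε ℓ d z = 0 ↔
        ∀ u e, deg e = d → ∑ c, strandCoeff ℓ u z c * ((ε c e : ℤ) : k) = 0 := by
    intro d z
    constructor
    · intro hz u e he
      rw [← strandCoeff_cellularDifferential hmono u z e he, hz]
      simp [strandCoeff]
    · intro hz
      obtain ⟨U, hU⟩ := exists_eq_sum_strandElement (ℓ := ℓ) (cellularDifferential k deg ε ℓ d z)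
      rw [hU]
      refine Finset.sum_eq_zero fun u _ => Finsupp.ext fun e => ?_
      rw [strandElement_apply _ _ _ _ fun h => (strandCoeff_support h).2,
        strandCoeff_cellularDifferential hmono u z e e.2, hz u e e.2]
      simp
  constructor
  · intro H u d g hg hg0
    have hz : cellularDifferential k deg ε ℓ d (strandElement ℓ deg (d + 1) u g) = 0 := by
      rw [cellularDifferential_strandElement hmono hg (g' := 0) fun e he => (hg0 e he).symm]
      refine Finsupp.ext fun c => ?_
      rw [strandElement_apply _ _ _ _ (by simp)]
      simp
    obtain ⟨y, hy⟩ := (H d _).1 hz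
    refine ⟨strandCoeff ℓ u y, fun c hc => strandCoeff_support hc, fun e he => ?_⟩
    rw [← strandCoeff_cellularDifferential hmono u y e he, hy, strandCoeff_strandElement hg]
  · intro H d z
    constructor
    · intro hz
      obtain ⟨U, hU⟩ := exists_eq_sum_strandElement (ℓ := ℓ) z
      rw [← LinearMap.coe_range, SetLike.mem_coe, hU]
      refine Submodule.sum_mem _ fun u _ => ?_
      obtain ⟨h, hh, hgh⟩ := H u d (strandCoeff ℓ u z) (fun c hc => strandCoeff_support hc)
        ((hcycle z).1 hz u)
      exact ⟨strandElement ℓ deg (d + 2) u h, cellularDifferential_strandElement hmono hh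
        fun e he => (hgh e he).symm⟩
    · rintro ⟨y, rfl⟩
      rw [hcycle]
      intro u e he
      exact hsq.boundary_boundary (fun c hc => (strandCoeff_support hc).1) he
        (fun c hc => (strandCoeff_support hc).1)
        (fun c hc => strandCoeff_cellularDifferential hmono u y c hc)

end Strands

/-! ### Faces and signs of Visscher's complex -/

section Combinatorics

open Finset

theorem Finset.neg_one_pow_card_filter_lt_cancel {α : Type*} [LinearOrder α] {T : Finset α}
    {x y : α} (hx : x ∈ T) (hy : y ∈ T) (hxy : x ≠ y) :
    (-1 : ℤ) ^ #{z ∈ T | z < x} * (-1) ^ #{z ∈ T.erase x | z < y} +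
      (-1) ^ #{z ∈ T | z < y} * (-1) ^ #{z ∈ T.erase y | z < x} = 0 := by
  wlog h : x < y generalizing x y
  · rw [add_comm]
    exact this hy hx hxy.symm (lt_of_le_of_ne (not_lt.1 h) hxy.symm)
  have h1 : #{z ∈ T.erase x | z < y} + 1 = #{z ∈ T | z < y} := by
    rw [filter_erase, card_erase_add_one (by simp [hx, h])]
  have h2 : #{z ∈ T.erase y | z < x} = #{z ∈ T | z < x} := by
    rw [filter_erase, erase_eq_of_notMem (by simp [h.le])]
  rw [h2, ← h1, pow_succ]
  ring

theorem Finset.neg_one_pow_card_filter_lt_pair {α : Type*} [LinearOrder α] {x y : α}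
    (hxy : x ≠ y) :
    (-1 : ℤ) ^ #{z ∈ ({x, y} : Finset α) | z < x} + (-1) ^ #{z ∈ ({x, y} : Finset α) | z < y}
      = 0 := by
  rcases hxy.lt_or_gt with h | h <;>
    simp [filter_insert, filter_singleton, h, h.not_gt]

variable {ι κ : Type*}

namespace VisscherCell

theorem le_iff {c c' : VisscherCell ι κ} : c' ≤ c ↔ c'.1.1 ⊆ c.1.1 ∧ c'.1.2 ⊆ c.1.2 := Iff.rfl

/-- The vertices of the bipartite graph that belong to the cell `(A, B)`. The signs of Visscher's
differential are the usual simplicial signs for the lexicographic order on this set. -/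
def vertices (c : VisscherCell ι κ) : Finset (ι ⊕ₗ κ) :=
  (c.1.1.disjSum c.1.2).map toLex.toEmbedding

@[simp]
theorem inl_mem_vertices {c : VisscherCell ι κ} {a : ι} :
    toLex (Sum.inl a) ∈ c.vertices ↔ a ∈ c.1.1 := by
  simp [vertices]

@[simp]
theorem inr_mem_vertices {c : VisscherCell ι κ} {b : κ} :
    toLex (Sum.inr b) ∈ c.vertices ↔ b ∈ c.1.2 := by
  simp [vertices]

theorem vertices_subset_iff {c c' : VisscherCell ι κ} : c'.vertices ⊆ c.vertices ↔ c' ≤ c := by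
  rw [le_iff]
  refine ⟨fun h => ⟨fun a ha => ?_, fun b hb => ?_⟩, fun h => ?_⟩
  · exact inl_mem_vertices.1 (h (inl_mem_vertices.2 ha))
  · exact inr_mem_vertices.1 (h (inr_mem_vertices.2 hb))
  · rintro (x | x) hx
    · exact inl_mem_vertices.2 (h.1 (inl_mem_vertices.1 hx))
    · exact inr_mem_vertices.2 (h.2 (inr_mem_vertices.1 hx))

theorem vertices_injective : Function.Injective (vertices : VisscherCell ι κ → _) :=
  fun _ _ h => le_antisymm (vertices_subset_iff.1 h.subset) (vertices_subset_iff.1 h.symm.subset)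

theorem card_vertices (c : VisscherCell ι κ) : #c.vertices = #c.1.1 + #c.1.2 := by
  simp [vertices]

theorem right_nonempty_iff {c : VisscherCell ι κ} : c.1.2.Nonempty ↔ c.1.1.Nonempty := by
  rw [Finset.nonempty_iff_ne_empty, Finset.nonempty_iff_ne_empty, Ne, Ne, c.2]

theorem degree_eq (c : VisscherCell ι κ) : visscherDegree c = #c.vertices - 1 := by
  rw [card_vertices, visscherDegree]

theorem degree_add_one {c : VisscherCell ι κ} (hc : c.1.1.Nonempty) :
    visscherDegree c + 1 = #c.1.1 + #c.1.2 := by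
  have := hc.card_pos
  rw [visscherDegree]
  omega

theorem degree_pos_iff {c : VisscherCell ι κ} : 0 < visscherDegree c ↔ c.1.1.Nonempty := by
  constructor
  · intro h
    rw [Finset.nonempty_iff_ne_empty]
    intro h0
    simp [visscherDegree, h0, c.2.1 h0] at h
  · intro h
    have h1 := h.card_pos
    have h2 := (right_nonempty_iff.2 h).card_pos
    rw [visscherDegree]
    omega

theorem degree_eq_zero_iff {c : VisscherCell ι κ} : visscherDegree c = 0 ↔ c.1.1 = ∅ := by
  rw [← Finset.not_nonempty_iff_eq_empty, ← degree_pos_iff]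
  omega

theorem degree_le_degree {c c' : VisscherCell ι κ} (h : c' ≤ c) :
    visscherDegree c' ≤ visscherDegree c := by
  have h1 := card_le_card h.1
  have h2 := card_le_card h.2
  simp only [visscherDegree]
  omega

theorem eq_of_le_of_degree_le {c c' : VisscherCell ι κ} (h : c' ≤ c)
    (hd : visscherDegree c ≤ visscherDegree c') : c' = c := by
  by_cases hc : c.1.1.Nonempty
  · have hc' : c'.1.1.Nonempty := by
      rw [← degree_pos_iff] at hc ⊢
      omega
    have h1 := card_le_card h.1
    have h2 := card_le_card h.2
    have h3 := degree_add_one hc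
    have h4 := degree_add_one hc'
    refine Subtype.ext (Prod.ext ?_ ?_)
    · exact Finset.eq_of_subset_of_card_le h.1 (by omega)
    · exact Finset.eq_of_subset_of_card_le h.2 (by omega)
  · rw [Finset.not_nonempty_iff_eq_empty] at hc
    have h1 : c'.1.1 = ∅ := Finset.subset_empty.1 (h.1.trans hc.subset)
    exact Subtype.ext (Prod.ext (by rw [h1, hc]) (by rw [c'.2.1 h1, c.2.1 hc]))

theorem exists_vertices_eq {T : Finset (ι ⊕ₗ κ)} (hl : ∃ a, toLex (Sum.inl a) ∈ T)
    (hr : ∃ b, toLex (Sum.inr b) ∈ T) : ∃ c : VisscherCell ι κ, c.vertices = T := by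
  obtain ⟨a, ha⟩ := hl
  obtain ⟨b, hb⟩ := hr
  have hl : a ∈ (T.map ofLex.toEmbedding).toLeft := by simpa [Finset.mem_toLeft] using ha
  have hr : b ∈ (T.map ofLex.toEmbedding).toRight := by simpa [Finset.mem_toRight] using hb
  refine ⟨⟨((T.map ofLex.toEmbedding).toLeft, (T.map ofLex.toEmbedding).toRight), ?_⟩, ?_⟩
  · exact iff_of_false (Finset.ne_empty_of_mem hl) (Finset.ne_empty_of_mem hr)
  · refine Finset.ext fun x => ?_
    obtain ⟨x | x, rfl⟩ := toLex.surjective x <;> simp [Finset.mem_toLeft, Finset.mem_toRight]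

variable [LinearOrder ι] [LinearOrder κ]

theorem exists_vertices_eq_erase {c c' : VisscherCell ι κ} (hc' : c'.1.1.Nonempty) (h : c' ≤ c)
    (hd : visscherDegree c = visscherDegree c' + 1) :
    ∃ x ∈ c.vertices, c'.vertices = c.vertices.erase x := by
  have hc : c.1.1.Nonempty := hc'.mono h.1
  have h1 := degree_add_one hc
  have h2 := degree_add_one hc'
  have hsub := vertices_subset_iff.2 h
  have hcard : #(c.vertices \ c'.vertices) = 1 := by
    rw [card_sdiff_of_subset hsub, card_vertices, card_vertices]
    omega
  obtain ⟨x, hx⟩ := card_eq_one.1 hcard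
  have hxc : x ∈ c.vertices \ c'.vertices := by simp [hx]
  refine ⟨x, (mem_sdiff.1 hxc).1, ?_⟩
  rw [erase_eq, ← hx, Finset.sdiff_sdiff_eq_self hsub]

end VisscherCell

open VisscherCell

variable [LinearOrder ι] [LinearOrder κ]

theorem visscherSign_of_erase_left {c c' : VisscherCell ι κ} {a : ι} (ha : a ∈ c.1.1)
    (hc' : c'.1.1.Nonempty) (h : c'.1 = (c.1.1.erase a, c.1.2)) :
    visscherSign c c' = (-1) ^ #{x ∈ c.1.1 | x < a} := by
  rw [visscherSign, if_neg hc'.ne_empty, Finset.sum_eq_single a, if_pos h,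
    Finset.sum_eq_zero, add_zero]
  · intro b _
    rw [if_neg]
    intro h'
    rw [h] at h'
    exact Finset.erase_ne_self.2 ha (Prod.ext_iff.1 h').1
  · intro a' ha' hne
    rw [if_neg]
    intro h'
    rw [h] at h'
    exact hne ((Finset.erase_inj _ ha).1 (Prod.ext_iff.1 h').1).symm
  · exact fun h' => absurd ha h'

theorem visscherSign_of_erase_right {c c' : VisscherCell ι κ} {b : κ} (hb : b ∈ c.1.2)
    (hc' : c'.1.1.Nonempty) (h : c'.1 = (c.1.1, c.1.2.erase b)) :
    visscherSign c c' = (-1) ^ (#c.1.1 + #{x ∈ c.1.2 | x < b}) := by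
  rw [visscherSign, if_neg hc'.ne_empty, Finset.sum_eq_zero, zero_add,
    Finset.sum_eq_single b, if_pos h]
  · intro b' hb' hne
    rw [if_neg]
    intro h'
    rw [h] at h'
    exact hne ((Finset.erase_inj _ hb).1 (Prod.ext_iff.1 h').2).symm
  · exact fun h' => absurd hb h'
  · intro a ha
    rw [if_neg]
    intro h'
    rw [h] at h'
    exact Finset.erase_ne_self.2 hb (Prod.ext_iff.1 h').2

theorem visscherSign_of_erase {c c' : VisscherCell ι κ} {x : ι ⊕ₗ κ} (hx : x ∈ c.vertices)
    (hc' : c'.1.1.Nonempty) (h : c'.vertices = c.vertices.erase x) :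
    visscherSign c c' = (-1) ^ #{y ∈ c.vertices | y < x} := by
  obtain ⟨a | b, rfl⟩ := toLex.surjective x
  · rw [inl_mem_vertices] at hx
    rw [visscherSign_of_erase_left hx hc']
    · have : {y ∈ c.vertices | y < toLex (Sum.inl a)} =
          (({y ∈ c.1.1 | y < a}).disjSum ∅).map toLex.toEmbedding := by
        ext y
        obtain ⟨y | y, rfl⟩ := toLex.surjective y <;> simp
      rw [this]
      simp
    · refine Prod.ext (Finset.ext fun y => ?_) (Finset.ext fun y => ?_)
      · rw [← inl_mem_vertices, h]
        simp
      · rw [← inr_mem_vertices, h]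
        simp
  · rw [inr_mem_vertices] at hx
    rw [visscherSign_of_erase_right hx hc']
    · have : {y ∈ c.vertices | y < toLex (Sum.inr b)} =
          (c.1.1.disjSum {y ∈ c.1.2 | y < b}).map toLex.toEmbedding := by
        ext y
        obtain ⟨y | y, rfl⟩ := toLex.surjective y <;> simp
      rw [this]
      simp
    · refine Prod.ext (Finset.ext fun y => ?_) (Finset.ext fun y => ?_)
      · rw [← inl_mem_vertices, h]
        simp
      · rw [← inr_mem_vertices, h]
        simp

theorem visscherSign_le {c c' : VisscherCell ι κ} (h : visscherSign c c' ≠ 0) : c' ≤ c := by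
  rw [visscherSign] at h
  split_ifs at h with h0
  · exact ⟨by simp [h0], by simp [c'.2.1 h0]⟩
  · by_contra hle
    apply h
    rw [Finset.sum_eq_zero, Finset.sum_eq_zero, add_zero]
    · intro b _
      rw [if_neg]
      intro h1
      exact hle ⟨(congrArg Prod.fst h1).le, (congrArg Prod.snd h1).le.trans (erase_subset _ _)⟩
    · intro a _
      rw [if_neg]
      intro h1
      exact hle ⟨(congrArg Prod.fst h1).le.trans (erase_subset _ _), (congrArg Prod.snd h1).le⟩

theorem visscherSign_of_empty {c c' : VisscherCell ι κ} (h : c'.1.1 = ∅) : visscherSign c c' = 1 :=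
  if_pos h

theorem visscherSign_eq_one_or_neg_one {c c' : VisscherCell ι κ} (h : c' ≤ c)
    (hd : visscherDegree c = visscherDegree c' + 1) :
    visscherSign c c' = 1 ∨ visscherSign c c' = -1 := by
  rcases c'.1.1.eq_empty_or_nonempty with h0 | h0
  · exact Or.inl (visscherSign_of_empty h0)
  · obtain ⟨x, hx, hx'⟩ := exists_vertices_eq_erase h0 h hd
    rw [visscherSign_of_erase hx h0 hx']
    exact neg_one_pow_eq_or ℤ _

theorem visscherSign_ne_zero_iff {c c' : VisscherCell ι κ}
    (hd : visscherDegree c = visscherDegree c' + 1) : visscherSign c c' ≠ 0 ↔ c' ≤ c := by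
  refine ⟨visscherSign_le, fun h => ?_⟩
  rcases visscherSign_eq_one_or_neg_one h hd with h | h <;> simp [h]

/-- Between a cell and a face of codimension two there are exactly two intermediate faces, and their
contributions to the square of the differential cancel. -/
theorem exists_visscher_diamond {c e : VisscherCell ι κ} (hle : e ≤ c)
    (hd : visscherDegree c = visscherDegree e + 2) :
    ∃ c₁ c₂ : VisscherCell ι κ, c₁ ≠ c₂ ∧
      (∀ c', visscherDegree c' = visscherDegree e + 1 → e ≤ c' → c' ≤ c → c' = c₁ ∨ c' = c₂) ∧
      visscherDegree c₁ = visscherDegree e + 1 ∧ visscherDegree c₂ = visscherDegree e + 1 ∧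
      visscherSign c c₁ * visscherSign c₁ e + visscherSign c c₂ * visscherSign c₂ e = 0 := by
  have hc : c.1.1.Nonempty := degree_pos_iff.1 (by omega)
  have hcd := degree_add_one hc
  rcases e.1.1.eq_empty_or_nonempty with h0 | h0
  · have he0 : visscherDegree e = 0 := degree_eq_zero_iff.2 h0
    have hcard : #c.1.1 + #c.1.2 = 3 := by omega
    have hA := hc.card_pos
    have hB := (right_nonempty_iff.2 hc).card_pos
    rcases (by omega : #c.1.1 = 2 ∧ #c.1.2 = 1 ∨ #c.1.1 = 1 ∧ #c.1.2 = 2) with ⟨hA, hB⟩ | ⟨hA, hB⟩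
    · obtain ⟨a₁, a₂, hne, hA⟩ := card_eq_two.1 hA
      obtain ⟨b, hB⟩ := card_eq_one.1 hB
      refine ⟨⟨({a₂}, c.1.2), by simp [hB]⟩, ⟨({a₁}, c.1.2), by simp [hB]⟩, ?_, ?_, ?_, ?_, ?_⟩
      · intro h
        exact hne.symm (by simpa using congrArg (fun c => c.1.1) h)
      · intro c' hd' _ hc'
        have hne' : c'.1.1.Nonempty := degree_pos_iff.1 (by omega)
        have h1 := degree_add_one hne'
        have h2 := (right_nonempty_iff.2 hne').card_pos
        obtain ⟨z, hz⟩ := card_eq_one.1 (show #c'.1.1 = 1 by have := hne'.card_pos; omega)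
        have hB' : c'.1.2 = c.1.2 :=
          Finset.eq_of_subset_of_card_le hc'.2 (by rw [hB, card_singleton]; omega)
        have hzc : z ∈ c.1.1 := hc'.1 (by simp [hz])
        rw [hA, mem_insert, mem_singleton] at hzc
        rcases hzc with rfl | rfl
        · exact Or.inr (Subtype.ext (Prod.ext hz hB'))
        · exact Or.inl (Subtype.ext (Prod.ext hz hB'))
      · rw [he0]
        simp [visscherDegree, hB]
      · rw [he0]
        simp [visscherDegree, hB]
      · rw [visscherSign_of_empty h0, visscherSign_of_empty h0,
          visscherSign_of_erase_left (a := a₁) (by simp [hA]) (by simp)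
            (by simp [hA, Finset.erase_insert_eq_erase, hne]),
          visscherSign_of_erase_left (a := a₂) (by simp [hA]) (by simp)
            (by rw [hA, pair_comm]; simp [Finset.erase_insert_eq_erase, hne.symm]), hA]
        simpa using Finset.neg_one_pow_card_filter_lt_pair hne
    · obtain ⟨b₁, b₂, hne, hB⟩ := card_eq_two.1 hB
      obtain ⟨a, hA⟩ := card_eq_one.1 hA
      refine ⟨⟨(c.1.1, {b₂}), by simp [hA]⟩, ⟨(c.1.1, {b₁}), by simp [hA]⟩, ?_, ?_, ?_, ?_, ?_⟩
      · intro h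
        exact hne.symm (by simpa using congrArg (fun c => c.1.2) h)
      · intro c' hd' _ hc'
        have hne' : c'.1.1.Nonempty := degree_pos_iff.1 (by omega)
        have h1 := degree_add_one hne'
        have h2 := hne'.card_pos
        obtain ⟨z, hz⟩ := card_eq_one.1
          (show #c'.1.2 = 1 by have := (right_nonempty_iff.2 hne').card_pos; omega)
        have hA' : c'.1.1 = c.1.1 :=
          Finset.eq_of_subset_of_card_le hc'.1 (by rw [hA, card_singleton]; omega)
        have hzc : z ∈ c.1.2 := hc'.2 (by simp [hz])
        rw [hB, mem_insert, mem_singleton] at hzc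
        rcases hzc with rfl | rfl
        · exact Or.inr (Subtype.ext (Prod.ext hA' hz))
        · exact Or.inl (Subtype.ext (Prod.ext hA' hz))
      · rw [he0]
        simp [visscherDegree, hA]
      · rw [he0]
        simp [visscherDegree, hA]
      · rw [visscherSign_of_empty h0, visscherSign_of_empty h0,
          visscherSign_of_erase_right (b := b₁) (by simp [hB]) (by simp [hA])
            (by simp [hB, Finset.erase_insert_eq_erase, hne]),
          visscherSign_of_erase_right (b := b₂) (by simp [hB]) (by simp [hA])
            (by rw [hB, pair_comm]; simp [Finset.erase_insert_eq_erase, hne.symm]), hB]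
        rw [pow_add, pow_add, mul_assoc, mul_assoc, ← mul_add]
        refine mul_eq_zero_of_right _ ?_
        simpa using Finset.neg_one_pow_card_filter_lt_pair hne
  · have hed := degree_add_one h0
    have hsub := vertices_subset_iff.2 hle
    have hcard : #(c.vertices \ e.vertices) = 2 := by
      rw [card_sdiff_of_subset hsub, card_vertices, card_vertices]
      omega
    obtain ⟨x, y, hxy, hxy'⟩ := card_eq_two.1 hcard
    obtain ⟨hxc, hxe⟩ := mem_sdiff.1 (show x ∈ c.vertices \ e.vertices by simp [hxy'])
    obtain ⟨hyc, hye⟩ := mem_sdiff.1 (show y ∈ c.vertices \ e.vertices by simp [hxy'])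
    have he : e.vertices = (c.vertices.erase x).erase y := by
      rw [← Finset.sdiff_sdiff_eq_self hsub, hxy']
      ext z; simp; tauto
    have hmk : ∀ z, z ∉ e.vertices → ∃ c' : VisscherCell ι κ, c'.vertices = c.vertices.erase z := by
      intro z hz
      have hsub' : e.vertices ⊆ c.vertices.erase z := subset_erase.2 ⟨hsub, hz⟩
      obtain ⟨b, hb⟩ := right_nonempty_iff.2 h0
      obtain ⟨a, ha⟩ := h0
      exact exists_vertices_eq ⟨a, hsub' (inl_mem_vertices.2 ha)⟩ ⟨b, hsub' (inr_mem_vertices.2 hb)⟩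
    obtain ⟨c₁, hc₁⟩ := hmk x hxe
    obtain ⟨c₂, hc₂⟩ := hmk y hye
    have he₁ : e ≤ c₁ := by
      rw [← vertices_subset_iff, hc₁]; exact subset_erase.2 ⟨hsub, hxe⟩
    have he₂ : e ≤ c₂ := by
      rw [← vertices_subset_iff, hc₂]; exact subset_erase.2 ⟨hsub, hye⟩
    have hdeg : ∀ (c' : VisscherCell ι κ) (z : ι ⊕ₗ κ), z ∈ c.vertices →
        c'.vertices = c.vertices.erase z → visscherDegree c' = visscherDegree e + 1 := by
      intro c' z hz hc'
      have := card_erase_add_one hz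
      rw [card_vertices c] at this
      rw [degree_eq, hc']
      omega
    refine ⟨c₁, c₂, ?_, ?_, hdeg c₁ x hxc hc₁, hdeg c₂ y hyc hc₂, ?_⟩
    · rintro rfl
      exact hxy ((Finset.erase_inj _ hxc).1 (hc₁.symm.trans hc₂))
    · intro c' hd' hec' hc'
      obtain ⟨z, hz, hz'⟩ := exists_vertices_eq_erase (h0.mono hec'.1) hc' (by omega)
      have hze : z ∈ c.vertices \ e.vertices := by
        refine mem_sdiff.2 ⟨hz, fun h => ?_⟩
        have := vertices_subset_iff.2 hec' h
        simp [hz'] at this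
      rw [hxy', mem_insert, mem_singleton] at hze
      rcases hze with rfl | rfl
      · exact Or.inl (vertices_injective (hz'.trans hc₁.symm))
      · exact Or.inr (vertices_injective (hz'.trans hc₂.symm))
    · have hy₁ : y ∈ c₁.vertices := by simp [hc₁, hyc, hxy.symm]
      have hx₂ : x ∈ c₂.vertices := by simp [hc₂, hxc, hxy]
      rw [visscherSign_of_erase hxc (h0.mono he₁.1) hc₁,
        visscherSign_of_erase hyc (h0.mono he₂.1) hc₂,
        visscherSign_of_erase hy₁ h0 (by rw [he, hc₁]),
        visscherSign_of_erase hx₂ h0 (by rw [he, hc₂, erase_right_comm]), hc₁, hc₂]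
      exact Finset.neg_one_pow_card_filter_lt_cancel hxc hyc hxy

theorem visscherSign_cancel {c c₁ c₂ e : VisscherCell ι κ}
    (hd : visscherDegree c = visscherDegree e + 2) (hd₁ : visscherDegree c₁ = visscherDegree e + 1)
    (hd₂ : visscherDegree c₂ = visscherDegree e + 1) (hne : c₁ ≠ c₂) (h₁ : c₁ ≤ c) (h₂ : c₂ ≤ c)
    (he₁ : e ≤ c₁) (he₂ : e ≤ c₂) :
    visscherSign c c₁ * visscherSign c₁ e + visscherSign c c₂ * visscherSign c₂ e = 0 := by
  obtain ⟨x, y, -, hall, -, -, h⟩ := exists_visscher_diamond (he₁.trans h₁) hd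
  rcases hall c₁ hd₁ he₁ h₁ with rfl | rfl <;> rcases hall c₂ hd₂ he₂ h₂ with rfl | rfl
  · exact absurd rfl hne
  · exact h
  · rw [add_comm]; exact h
  · exact absurd rfl hne

variable [Fintype ι] [Fintype κ]

theorem squaresToZero_visscherSign (k : Type*) [Field k] :
    SquaresToZero (visscherDegree (ι := ι) (κ := κ))
      fun c c' => ((visscherSign c c' : ℤ) : k) := by
  intro c e hd
  by_cases hle : e ≤ c
  · obtain ⟨x, y, hne, hall, hx, hy, h⟩ := exists_visscher_diamond hle hd
    rw [← Finset.sum_subset (subset_univ {x, y}), Finset.sum_pair hne, if_pos hx, if_pos hy]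
    · have := congrArg (Int.cast : ℤ → k) h
      push_cast at this
      exact this
    · intro c' _ hc'
      by_contra h0
      rw [ite_eq_right_iff, Classical.not_imp] at h0
      have h1 := visscherSign_le (c := c) (c' := c') fun h1 => h0.2 (by simp [h1])
      have h2 := visscherSign_le (c := c') (c' := e) fun h1 => h0.2 (by simp [h1])
      rcases hall c' h0.1 h2 h1 with rfl | rfl <;> simp at hc'
  · refine Finset.sum_eq_zero fun c' _ => ?_
    by_contra h0
    rw [ite_eq_right_iff, Classical.not_imp] at h0
    have h1 := visscherSign_le (c := c) (c' := c') fun h1 => h0.2 (by simp [h1])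
    have h2 := visscherSign_le (c := c') (c' := e) fun h1 => h0.2 (by simp [h1])
    exact hle (h2.trans h1)

end Combinatorics

/-! ### The product of two simplices as a regular cell complex -/

section Topology

open Finset

/-- The open face of the standard simplex spanned by the vertices in `A`. -/
def openFace {ι : Type*} [Fintype ι] (A : Finset ι) : Set (stdSimplex ℝ ι) :=
  {x | ∀ i, x.1 i ≠ 0 ↔ i ∈ A}

section Simplex

variable {ι : Type*} [Fintype ι]

theorem isClosed_setOf_support_subset (A : Finset ι) :
    IsClosed {x : stdSimplex ℝ ι | ∀ i, x.1 i ≠ 0 → i ∈ A} := by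
  have : {x : stdSimplex ℝ ι | ∀ i, x.1 i ≠ 0 → i ∈ A} =
      ⋂ i ∈ {i | i ∉ A}, {x : stdSimplex ℝ ι | x.1 i = 0} := by
    ext x
    simp only [Set.mem_ofPred_eq, Set.mem_iInter]
    exact forall_congr' fun i => not_imp_comm
  rw [this]
  exact isClosed_biInter fun i _ =>
    isClosed_eq ((continuous_apply i).comp continuous_subtype_val) continuous_const

theorem openFace_nonempty {A : Finset ι} (hA : A.Nonempty) : (openFace A).Nonempty := by
  classical
  have hpos : (0 : ℝ) < #A := by exact_mod_cast hA.card_pos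
  refine ⟨⟨fun i => if i ∈ A then (#A : ℝ)⁻¹ else 0, fun i => ?_, ?_⟩, fun i => ?_⟩
  · dsimp only
    split_ifs <;> positivity
  · simp [hpos.ne']
  · by_cases hi : i ∈ A <;> simp [hi, hpos.ne']

theorem openFace_empty : openFace (∅ : Finset ι) = ∅ := by
  refine Set.eq_empty_of_forall_notMem fun x hx => ?_
  have h1 := x.2.2
  rw [Finset.sum_eq_zero fun i _ => by simpa using (hx i)] at h1
  exact zero_ne_one h1

theorem stdSimplex_support_ne_empty (x : stdSimplex ℝ ι) :
    ({i | x.1 i ≠ 0} : Finset ι) ≠ ∅ := by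
  intro h
  have h1 := x.2.2
  rw [Finset.sum_eq_zero fun i _ => by simpa using Finset.ext_iff.1 h i] at h1
  exact zero_ne_one h1

theorem closure_openFace {A : Finset ι} (hA : A.Nonempty) :
    closure (openFace A) = {x | ∀ i, x.1 i ≠ 0 → i ∈ A} := by
  refine Set.Subset.antisymm
    (closure_minimal (fun x hx i => (hx i).1) (isClosed_setOf_support_subset A)) fun x hx => ?_
  obtain ⟨b, hb⟩ := openFace_nonempty hA
  rw [closure_subtype]
  refine closure_mono ?_ (segment_subset_closure_openSegment (left_mem_segment ℝ x.1 b.1))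
  intro y hy
  have hyS := (convex_stdSimplex ℝ ι).openSegment_subset x.2 b.2 hy
  refine ⟨⟨y, hyS⟩, fun i => ?_, rfl⟩
  obtain ⟨s, t, hs, ht, -, rfl⟩ := hy
  have hx0 := x.2.1 i
  have hb0 := b.2.1 i
  change s * x.1 i + t * b.1 i ≠ 0 ↔ _
  constructor
  · intro h
    by_contra hi
    have h1 : x.1 i = 0 := by by_contra h1; exact hi (hx i h1)
    have h2 : b.1 i = 0 := by by_contra h2; exact hi ((hb i).1 h2)
    simp [h1, h2] at h
  · intro hi
    have h2 : 0 < b.1 i := lt_of_le_of_ne hb0 (Ne.symm ((hb i).2 hi))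
    positivity

/-- Affine coordinates on the face `A` of the standard simplex: all barycentric coordinates but that
of one vertex `a` of `A`. -/
def faceCoordinates [DecidableEq ι] (A : Finset ι) (a : ι) (x : stdSimplex ℝ ι) :
    {i // i ∈ A.erase a} → ℝ :=
  fun i => x.1 i

/-- The open standard simplex in affine coordinates. -/
def openCornerSimplex (J : Type*) [Fintype J] : Set (J → ℝ) :=
  {z | (∀ j, 0 < z j) ∧ ∑ j, z j < 1}

theorem isOpen_openCornerSimplex (J : Type*) [Fintype J] : IsOpen (openCornerSimplex J) := by
  have : openCornerSimplex J = (⋂ j, {z : J → ℝ | 0 < z j}) ∩ {z | ∑ j, z j < 1} := by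
    ext z; simp [openCornerSimplex]
  rw [this]
  exact (isOpen_iInter_of_finite fun j => isOpen_lt continuous_const (continuous_apply j)).inter
    (isOpen_lt (by fun_prop) continuous_const)

theorem convex_openCornerSimplex (J : Type*) [Fintype J] : Convex ℝ (openCornerSimplex J) := by
  have : openCornerSimplex J = (⋂ j, {z : J → ℝ | 0 < z j}) ∩ {z | ∑ j, z j < 1} := by
    ext z; simp [openCornerSimplex]
  rw [this]
  refine (convex_iInter fun j => ?_).inter ?_
  · exact convex_halfSpace_gt (LinearMap.proj j : (J → ℝ) →ₗ[ℝ] ℝ).isLinear 0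
  · have := convex_halfSpace_lt (∑ j, LinearMap.proj j : (J → ℝ) →ₗ[ℝ] ℝ).isLinear 1
    simpa using this

variable [DecidableEq ι]

theorem continuous_faceCoordinates (A : Finset ι) (a : ι) : Continuous (faceCoordinates A a) :=
  continuous_pi fun i => (continuous_apply i.1).comp continuous_subtype_val

theorem sum_faceCoordinates {A : Finset ι} {a : ι} (ha : a ∈ A) {x : stdSimplex ℝ ι}
    (hx : ∀ i, x.1 i ≠ 0 → i ∈ A) : x.1 a + ∑ j, faceCoordinates A a x j = 1 := by
  have h1 : ∑ j, faceCoordinates A a x j = ∑ i ∈ A.erase a, x.1 i :=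
    Finset.sum_coe_sort (A.erase a) fun i => x.1 i
  rw [h1, Finset.add_sum_erase A _ ha, ← x.2.2]
  exact Finset.sum_subset (subset_univ _) fun i _ hi => by
    by_contra h; exact hi (hx i h)

theorem faceCoordinates_injOn {A : Finset ι} {a : ι} (ha : a ∈ A) :
    Set.InjOn (faceCoordinates A a) {x | ∀ i, x.1 i ≠ 0 → i ∈ A} := by
  intro x hx y hy hxy
  refine Subtype.ext (funext fun i => ?_)
  by_cases hi : i ∈ A
  · by_cases hia : i = a
    · subst hia
      have h1 := sum_faceCoordinates hi hx
      have h2 := sum_faceCoordinates hi hy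
      rw [hxy] at h1
      linarith
    · exact congrFun hxy ⟨i, mem_erase.2 ⟨hia, hi⟩⟩
  · have h1 : x.1 i = 0 := by by_contra h; exact hi (hx i h)
    have h2 : y.1 i = 0 := by by_contra h; exact hi (hy i h)
    rw [h1, h2]

theorem image_faceCoordinates_openFace {A : Finset ι} {a : ι} (ha : a ∈ A) :
    faceCoordinates A a '' openFace A = openCornerSimplex {i // i ∈ A.erase a} := by
  ext z
  constructor
  · rintro ⟨x, hx, rfl⟩
    have hpos : ∀ i ∈ A, 0 < x.1 i := fun i hi =>
      lt_of_le_of_ne (x.2.1 i) (Ne.symm ((hx i).2 hi))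
    refine ⟨fun j => hpos j (mem_of_mem_erase j.2), ?_⟩
    have := sum_faceCoordinates ha fun i => (hx i).1
    linarith [hpos a ha]
  · rintro ⟨hz, hz1⟩
    set f : ι → ℝ := fun i => if h : i ∈ A.erase a then z ⟨i, h⟩ else
      if i = a then 1 - ∑ j, z j else 0 with hf
    have hfa : f a = 1 - ∑ j, z j := by simp [hf]
    have hfj : ∀ i (h : i ∈ A.erase a), f i = z ⟨i, h⟩ := fun i h => dif_pos h
    have hf0 : ∀ i, i ∉ A → f i = 0 := by
      intro i hi
      have : i ≠ a := by rintro rfl; exact hi ha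
      simp [hf, hi, this]
    have hfpos : ∀ i ∈ A, 0 < f i := by
      intro i hi
      by_cases hia : i = a
      · rw [hia, hfa]; linarith
      · rw [hfj i (mem_erase.2 ⟨hia, hi⟩)]; exact hz _
    refine ⟨⟨f, fun i => ?_, ?_⟩, fun i => ⟨fun h => ?_, fun h => (hfpos i h).ne'⟩, ?_⟩
    · by_cases hi : i ∈ A
      · exact (hfpos i hi).le
      · exact (hf0 i hi).ge
    · rw [← Finset.sum_subset (subset_univ A) fun i _ hi => hf0 i hi,
        ← Finset.add_sum_erase A _ ha, hfa, (Finset.sum_coe_sort (A.erase a) f).symm.trans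
          (Finset.sum_congr rfl fun j _ => hfj j.1 j.2)]
      simp
    · by_contra hi; exact h (hf0 i hi)
    · exact funext fun j => hfj j j.2

end Simplex

/-- If a subset `D` of a compact space is mapped continuously onto a nonempty convex open set of a
`d`-dimensional normed space, injectively on the closure of `D`, then the closure of `D` is a closed
ball with interior `D`. -/
theorem exists_homeomorph_closedBall_closure {X E : Type*} [TopologicalSpace X] [CompactSpace X]
    [NormedAddCommGroup E] [NormedSpace ℝ E] [FiniteDimensional ℝ E] {d : ℕ}
    (hd : Module.finrank ℝ E = d) (f : X → E) (hf : Continuous f) {D : Set X} (hD : D.Nonempty)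
    (hinj : Set.InjOn f (closure D)) (hopen : IsOpen (f '' D)) (hconv : Convex ℝ (f '' D)) :
    ∃ h : Metric.closedBall (0 : EuclideanSpace ℝ (Fin d)) 1 ≃ₜ closure D,
      ∀ x, (h x : X) ∈ D ↔ ‖(x : EuclideanSpace ℝ (Fin d))‖ < 1 := by
  let L : E ≃L[ℝ] EuclideanSpace ℝ (Fin d) := ContinuousLinearEquiv.ofFinrankEq (by simp [hd])
  set g : X → EuclideanSpace ℝ (Fin d) := L ∘ f with hg
  have hgc : Continuous g := L.continuous.comp hf
  have himg : ∀ s, g '' s = L '' (f '' s) := fun s => Set.image_comp _ _ _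
  have hgopen : IsOpen (g '' D) := by
    rw [himg]; exact L.toHomeomorph.isOpenMap _ hopen
  have hgconv : Convex ℝ (g '' D) := by
    rw [himg]; exact hconv.linear_image L.toLinearMap
  have hginj : Set.InjOn g (closure D) := L.injective.comp_injOn hinj
  have hbdd : Bornology.IsBounded (g '' D) :=
    (isCompact_range hgc).isBounded.subset (Set.image_subset_range _ _)
  have hclos : g '' closure D = closure (g '' D) :=
    image_closure_of_isCompact isClosed_closure.isCompact hgc.continuousOn
  obtain ⟨e, he1, he2, -⟩ := exists_homeomorph_image_interior_closure_frontier_eq_unitBall hgconv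
    (by rw [hgopen.interior_eq]; exact hD.image g) hbdd
  rw [hgopen.interior_eq] at he1
  have : CompactSpace (closure D) := isCompact_iff_compactSpace.1 isClosed_closure.isCompact
  let φ : closure D → Metric.closedBall (0 : EuclideanSpace ℝ (Fin d)) 1 := fun x =>
    ⟨e (g x), by rw [← he2, ← hclos]; exact ⟨_, ⟨x, x.2, rfl⟩, rfl⟩⟩
  have hφc : Continuous φ :=
    (e.continuous.comp (hgc.comp continuous_subtype_val)).subtype_mk _
  have hφ : Function.Bijective φ := by
    constructor
    · intro x y hxy
      exact Subtype.ext (hginj x.2 y.2 (e.injective (congrArg Subtype.val hxy)))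
    · rintro ⟨y, hy⟩
      rw [← he2, ← hclos] at hy
      obtain ⟨_, ⟨x, hx, rfl⟩, rfl⟩ := hy
      exact ⟨⟨x, hx⟩, rfl⟩
  let H : closure D ≃ₜ Metric.closedBall (0 : EuclideanSpace ℝ (Fin d)) 1 :=
    Continuous.homeoOfEquivCompactToT2 (f := Equiv.ofBijective φ hφ) hφc
  have hH : ∀ x : closure D, (x : X) ∈ D ↔ ‖(H x : EuclideanSpace ℝ (Fin d))‖ < 1 := by
    intro x
    have h1 : (H x : EuclideanSpace ℝ (Fin d)) = e (g x) := rfl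
    rw [h1, ← mem_ball_zero_iff, ← he1]
    constructor
    · intro hx
      exact ⟨_, ⟨x, hx, rfl⟩, rfl⟩
    · rintro ⟨_, ⟨y, hy, rfl⟩, hxy⟩
      rw [← hginj (subset_closure hy) x.2 (e.injective hxy)]
      exact hy
  exact ⟨H.symm, fun x => by rw [hH (H.symm x), H.apply_symm_apply]⟩

open VisscherCell

variable {ι κ : Type*} [Fintype ι] [Fintype κ]

theorem visscherRealization_eq (c : VisscherCell ι κ) :
    visscherRealization c = openFace c.1.1 ×ˢ openFace c.1.2 := rfl

theorem visscherRealization_of_empty {c : VisscherCell ι κ} (hc : c.1.1 = ∅) :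
    visscherRealization c = ∅ := by
  rw [visscherRealization_eq, hc, openFace_empty, Set.empty_prod]

theorem visscherRealization_nonempty {c : VisscherCell ι κ} (hc : c.1.1.Nonempty) :
    (visscherRealization c).Nonempty :=
  (openFace_nonempty hc).prod (openFace_nonempty (right_nonempty_iff.2 hc))

theorem mem_closure_visscherRealization {c : VisscherCell ι κ} (hc : c.1.1.Nonempty)
    {p : stdSimplex ℝ ι × stdSimplex ℝ κ} :
    p ∈ closure (visscherRealization c) ↔
      (∀ i, p.1.1 i ≠ 0 → i ∈ c.1.1) ∧ ∀ j, p.2.1 j ≠ 0 → j ∈ c.1.2 := by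
  rw [visscherRealization_eq, closure_prod_eq, closure_openFace hc,
    closure_openFace (right_nonempty_iff.2 hc)]
  rfl

theorem visscherRealization_subset_closure_iff {c c' : VisscherCell ι κ} :
    visscherRealization c' ⊆ closure (visscherRealization c) ↔ c' ≤ c := by
  rw [le_iff]
  rcases c'.1.1.eq_empty_or_nonempty with h' | h'
  · simp [visscherRealization_of_empty h', h', c'.2.1 h']
  rcases c.1.1.eq_empty_or_nonempty with h | h
  · rw [visscherRealization_of_empty h, closure_empty, Set.subset_empty_iff]
    refine iff_of_false (visscherRealization_nonempty h').ne_empty fun hle => ?_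
    exact h'.ne_empty (Finset.subset_empty.1 (hle.1.trans h.subset))
  constructor
  · intro hsub
    obtain ⟨p, hp⟩ := visscherRealization_nonempty h'
    have := (mem_closure_visscherRealization h).1 (hsub hp)
    exact ⟨fun i hi => this.1 i ((hp.1 i).2 hi), fun j hj => this.2 j ((hp.2 j).2 hj)⟩
  · intro hle p hp
    rw [mem_closure_visscherRealization h]
    exact ⟨fun i hi => hle.1 ((hp.1 i).1 hi), fun j hj => hle.2 ((hp.2 j).1 hj)⟩

/-- Every point of the product of the two simplices lies in the cell given by its supports. -/
theorem exists_mem_visscherRealization (p : stdSimplex ℝ ι × stdSimplex ℝ κ) :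
    ∃ c : VisscherCell ι κ, p ∈ visscherRealization c := by
  classical
  refine ⟨⟨(({i | p.1.1 i ≠ 0} : Finset ι), ({j | p.2.1 j ≠ 0} : Finset κ)), ?_⟩, ?_, ?_⟩
  · exact iff_of_false (stdSimplex_support_ne_empty p.1) (stdSimplex_support_ne_empty p.2)
  · simp
  · simp

theorem visscherRealization_eq_of_mem {c c' : VisscherCell ι κ}
    {p : stdSimplex ℝ ι × stdSimplex ℝ κ} (h : p ∈ visscherRealization c)
    (h' : p ∈ visscherRealization c') : c = c' :=
  Subtype.ext (Prod.ext (Finset.ext fun i => (h.1 i).symm.trans (h'.1 i))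
    (Finset.ext fun j => (h.2 j).symm.trans (h'.2 j)))

variable [LinearOrder ι] [LinearOrder κ]

theorem isFiniteRegularCellComplex_visscher [Nonempty ι] [Nonempty κ] :
    IsFiniteRegularCellComplex (visscherDegree (ι := ι) (κ := κ)) visscherRealization where
  nonempty_space := inferInstance
  hausdorff := inferInstance
  finite_cells := inferInstance
  pairwise_disjoint c c' hne := Set.disjoint_left.2 fun _ hp hp' =>
    hne (visscherRealization_eq_of_mem hp hp')
  iUnion_eq := Set.eq_univ_of_forall fun p => Set.mem_iUnion.2 (exists_mem_visscherRealization p)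
  unique_empty_cell := by
    refine ⟨⟨(∅, ∅), by simp⟩, by simp [visscherDegree], fun c hc => ?_⟩
    have h1 := degree_eq_zero_iff.1 hc
    exact Subtype.ext (Prod.ext h1 (c.2.1 h1))
  cell_eq_empty_iff c := by
    rw [degree_eq_zero_iff]
    refine ⟨fun h => ?_, visscherRealization_of_empty⟩
    by_contra h0
    exact (visscherRealization_nonempty (Finset.nonempty_iff_ne_empty.2 h0)).ne_empty h
  closed_ball c d hd := by
    have hc : c.1.1.Nonempty := degree_pos_iff.1 (by omega)
    obtain ⟨a, ha⟩ := id hc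
    obtain ⟨b, hb⟩ := right_nonempty_iff.2 hc
    have hcard := degree_add_one hc
    have h1 := card_erase_add_one ha
    have h2 := card_erase_add_one hb
    have himg : Prod.map (faceCoordinates c.1.1 a) (faceCoordinates c.1.2 b) ''
        visscherRealization c = openCornerSimplex _ ×ˢ openCornerSimplex _ := by
      rw [visscherRealization_eq, Set.prodMap_image_prod, image_faceCoordinates_openFace ha,
        image_faceCoordinates_openFace hb]
    refine exists_homeomorph_closedBall_closure ?_
      (Prod.map (faceCoordinates c.1.1 a) (faceCoordinates c.1.2 b))
      ((continuous_faceCoordinates _ _).prodMap (continuous_faceCoordinates _ _))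
      (visscherRealization_nonempty hc) ?_ ?_ ?_
    · rw [Module.finrank_prod, Module.finrank_fintype_fun_eq_card,
        Module.finrank_fintype_fun_eq_card, Fintype.card_coe, Fintype.card_coe]
      omega
    · intro p hp q hq hpq
      rw [mem_closure_visscherRealization hc] at hp hq
      exact Prod.ext (faceCoordinates_injOn ha hp.1 hq.1 (congrArg Prod.fst hpq))
        (faceCoordinates_injOn hb hp.2 hq.2 (congrArg Prod.snd hpq))
    · rw [himg]
      exact (isOpen_openCornerSimplex _).prod (isOpen_openCornerSimplex _)
    · rw [himg]
      exact (convex_openCornerSimplex _).prod (convex_openCornerSimplex _)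
  boundary c := by
    rintro p ⟨hp, hpc⟩
    obtain ⟨c', hc'⟩ := exists_mem_visscherRealization p
    have hc : c.1.1.Nonempty := by
      rw [Finset.nonempty_iff_ne_empty]
      intro h
      simp [visscherRealization_of_empty h] at hp
    rw [mem_closure_visscherRealization hc] at hp
    have hle : c' ≤ c := ⟨fun i hi => hp.1 i ((hc'.1 i).2 hi), fun j hj => hp.2 j ((hc'.2 j).2 hj)⟩
    refine Set.mem_biUnion (show visscherDegree c' < visscherDegree c from ?_) hc'
    by_contra h
    rw [eq_of_le_of_degree_le hle (not_lt.1 h)] at hc'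
    exact hpc hc'

theorem isIncidenceFunction_visscherSign :
    IsIncidenceFunction (visscherDegree (ι := ι) (κ := κ)) visscherRealization visscherSign where
  values c c' hd := by
    by_cases h : c' ≤ c
    · exact Or.inr (visscherSign_eq_one_or_neg_one h hd)
    · exact Or.inl (not_not.1 fun h0 => h ((visscherSign_ne_zero_iff hd).1 h0))
  ne_zero_iff c c' hd := by
    rw [visscherSign_ne_zero_iff hd, visscherRealization_subset_closure_iff]
  empty_cell v e _ he := visscherSign_of_empty (degree_eq_zero_iff.1 he)
  cancel c c₁ c₂ e hd hd₁ hd₂ hne h₁ h₂ he₁ he₂ := by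
    rw [visscherRealization_subset_closure_iff] at h₁ h₂ he₁ he₂
    exact visscherSign_cancel hd hd₁ hd₂ hne h₁ h₂ he₁ he₂

end Topology

/-! ### Labels, minimality, and reduction to complexes of bicliques -/

section Resolution

open Finset VisscherCell MvPolynomial

variable {ι κ : Type*}

theorem edgeExponent_le_iff {ω : ι → κ → ℕ} {i : ι} {j : κ} {u : ι ⊕ κ →₀ ℕ} :
    edgeExponent ω i j ≤ u ↔ ω i j ≤ u (Sum.inl i) ∧ ω i j ≤ u (Sum.inr j) := by
  classical
  constructor
  · intro h
    have h1 := h (Sum.inl i)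
    have h2 := h (Sum.inr j)
    simp [edgeExponent] at h1 h2
    exact ⟨h1, h2⟩
  · rintro ⟨h1, h2⟩ (s | s)
    · by_cases hs : i = s
      · subst hs; simpa [edgeExponent] using h1
      · simp [edgeExponent, hs]
    · by_cases hs : j = s
      · subst hs; simpa [edgeExponent] using h2
      · simp [edgeExponent, hs]

theorem visscherLabel_le_iff {ω : ι → κ → ℕ} {c : VisscherCell ι κ} {u : ι ⊕ κ →₀ ℕ} :
    visscherLabel ω c ≤ u ↔ ∀ i ∈ c.1.1, ∀ j ∈ c.1.2, edgeExponent ω i j ≤ u := by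
  rw [visscherLabel, Finset.sup_le_iff]
  simp only [Prod.forall, mem_product, and_imp]
  exact ⟨fun h i hi j hj => h i j hi hj, fun h i j hi hj => h i hi j hj⟩

theorem visscherLabel_mono (ω : ι → κ → ℕ) {c c' : VisscherCell ι κ} (h : c' ≤ c) :
    visscherLabel ω c' ≤ visscherLabel ω c :=
  visscherLabel_le_iff.2 fun i hi j hj => visscherLabel_le_iff.1 le_rfl i (h.1 hi) j (h.2 hj)

theorem visscherLabel_support {ω : ι → κ → ℕ} {c : VisscherCell ι κ} {s : ι ⊕ κ}
    (hs : visscherLabel ω c s ≠ 0) : toLex s ∈ c.vertices := by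
  classical
  by_contra h
  have hle : visscherLabel ω c ≤ (visscherLabel ω c).erase s := by
    rw [visscherLabel_le_iff]
    intro i hi j hj
    have hij := edgeExponent_le_iff.1
      (visscherLabel_le_iff.1 (le_refl (visscherLabel ω c)) i hi j hj)
    rw [edgeExponent_le_iff, Finsupp.erase_ne, Finsupp.erase_ne]
    · exact hij
    · rintro rfl; exact h (inr_mem_vertices.2 hj)
    · rintro rfl; exact h (inl_mem_vertices.2 hi)
  have := hle s
  rw [Finsupp.erase_same] at this
  omega

/-- As the weights are positive, the label of a cell determines its vertices. -/
theorem le_of_visscherLabel_le {ω : ι → κ → ℕ} (hω : ∀ i j, 0 < ω i j) {c c' : VisscherCell ι κ}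
    (h : visscherLabel ω c ≤ visscherLabel ω c') : c ≤ c' := by
  have key : ∀ i ∈ c.1.1, ∀ j ∈ c.1.2, i ∈ c'.1.1 ∧ j ∈ c'.1.2 := by
    intro i hi j hj
    obtain ⟨h1, h2⟩ := edgeExponent_le_iff.1 (visscherLabel_le_iff.1 h i hi j hj)
    have := hω i j
    exact ⟨inl_mem_vertices.1 (visscherLabel_support (ω := ω) (by omega)),
      inr_mem_vertices.1 (visscherLabel_support (ω := ω) (by omega))⟩
  refine ⟨fun i hi => ?_, fun j hj => ?_⟩
  · obtain ⟨j, hj⟩ := right_nonempty_iff.2 ⟨i, hi⟩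
    exact (key i hi j hj).1
  · obtain ⟨i, hi⟩ := right_nonempty_iff.1 ⟨j, hj⟩
    exact (key i hi j hj).2

/-- The vertex `({i}, {j})` of Visscher's complex, which corresponds to the edge `X_i Y_j`. -/
def edgeCell (i : ι) (j : κ) : VisscherCell ι κ := ⟨({i}, {j}), by simp⟩

theorem visscherDegree_edgeCell (i : ι) (j : κ) : visscherDegree (edgeCell i j) = 1 := by
  simp [visscherDegree, edgeCell]

theorem edgeCell_le_iff {i : ι} {j : κ} {c : VisscherCell ι κ} :
    edgeCell i j ≤ c ↔ i ∈ c.1.1 ∧ j ∈ c.1.2 := by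
  simp [le_iff, edgeCell]

theorem visscherLabel_edgeCell (ω : ι → κ → ℕ) (i : ι) (j : κ) :
    visscherLabel ω (edgeCell i j) = edgeExponent ω i j := by
  simp [visscherLabel, edgeCell]

theorem exists_eq_edgeCell {c : VisscherCell ι κ} (hc : visscherDegree c = 1) :
    ∃ i j, c = edgeCell i j := by
  have hne : c.1.1.Nonempty := degree_pos_iff.1 (by omega)
  have h1 := degree_add_one hne
  have h2 := hne.card_pos
  have h3 := (right_nonempty_iff.2 hne).card_pos
  obtain ⟨i, hi⟩ := card_eq_one.1 (show #c.1.1 = 1 by omega)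
  obtain ⟨j, hj⟩ := card_eq_one.1 (show #c.1.2 = 1 by omega)
  exact ⟨i, j, Subtype.ext (Prod.ext hi hj)⟩

theorem subsingleton_visscherDegree_eq_zero :
    Subsingleton {c : VisscherCell ι κ // visscherDegree c = 0} := by
  refine ⟨fun c c' => Subtype.ext (Subtype.ext (Prod.ext ?_ ?_))⟩
  · rw [degree_eq_zero_iff.1 c.2, degree_eq_zero_iff.1 c'.2]
  · rw [c.1.2.1 (degree_eq_zero_iff.1 c.2), c'.1.2.1 (degree_eq_zero_iff.1 c'.2)]

theorem cellularAugmentation_single (k : Type*) [Field k] (I : Ideal (MvPolynomial (ι ⊕ κ) k))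
    (e : {c : VisscherCell ι κ // visscherDegree c = 0}) (p : MvPolynomial (ι ⊕ κ) k) :
    cellularAugmentation k visscherDegree I (Finsupp.single e p) = Ideal.Quotient.mk I p := by
  rw [cellularAugmentation, Finsupp.linearCombination_single]
  exact congrArg (Ideal.Quotient.mk I) (mul_one p)

theorem surjective_visscherAugmentation (k : Type*) [Field k]
    (I : Ideal (MvPolynomial (ι ⊕ κ) k)) :
    Function.Surjective (cellularAugmentation k (visscherDegree (ι := ι) (κ := κ)) I) := by
  intro y
  obtain ⟨p, rfl⟩ := Ideal.Quotient.mk_surjective y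
  exact ⟨Finsupp.single ⟨⟨(∅, ∅), by simp⟩, by simp [visscherDegree]⟩ p,
    cellularAugmentation_single k I _ p⟩

/-- The cells `(A, B)` all of whose edges `i j`, `i ∈ A`, `j ∈ B`, belong to the bipartite graph
`G`. -/
def IsBiclique (G : ι → κ → Prop) (c : VisscherCell ι κ) : Prop :=
  ∀ i ∈ c.1.1, ∀ j ∈ c.1.2, G i j

variable [Fintype ι] [Fintype κ]

theorem isMonomialLabelling_visscherLabel (ω : ι → κ → ℕ) :
    IsMonomialLabelling visscherDegree visscherRealization (visscherLabel ω) := by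
  intro c
  constructor
  · rintro _ ⟨v, -, hv, rfl⟩
    exact visscherLabel_mono ω (visscherRealization_subset_closure_iff.1 hv)
  · intro u hu
    rw [visscherLabel_le_iff]
    intro i hi j hj
    refine hu ⟨edgeCell i j, visscherDegree_edgeCell i j, ?_, (visscherLabel_edgeCell ω i j).symm⟩
    exact visscherRealization_subset_closure_iff.2 (edgeCell_le_iff.2 ⟨hi, hj⟩)

variable [LinearOrder ι] [LinearOrder κ] (k : Type*) [Field k]

theorem range_visscherDifferential_le {ω : ι → κ → ℕ} (hω : ∀ i j, 0 < ω i j) (d : ℕ) :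
    LinearMap.range (cellularDifferential k (visscherDegree (ι := ι) (κ := κ)) visscherSign
      (visscherLabel ω) d) ≤
    Ideal.span (Set.range (X : ι ⊕ κ → MvPolynomial (ι ⊕ κ) k)) • ⊤ := by
  rw [cellularDifferential, Finsupp.range_linearCombination, Submodule.span_le]
  rintro _ ⟨c, rfl⟩
  refine Submodule.sum_mem _ fun c' _ => ?_
  rw [← mul_one (monomial _ _), ← smul_eq_mul, ← Finsupp.smul_single]
  refine Submodule.smul_mem_smul ?_ trivial
  by_cases h0 : visscherSign c.1 c'.1 = 0
  · simp [h0]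
  have hlt : ¬ visscherLabel ω c.1 ≤ visscherLabel ω c'.1 := fun h => by
    have := degree_le_degree (le_of_visscherLabel_le hω h)
    rw [c.2, c'.2] at this
    omega
  rw [← tsub_eq_zero_iff_le] at hlt
  obtain ⟨s, hs⟩ := Finsupp.ne_iff.1 hlt
  exact Ideal.mem_of_dvd _ (X_dvd_monomial.2 (Or.inr hs)) (Ideal.subset_span ⟨s, rfl⟩)

theorem cellularDifferential_visscher_single (ω : ι → κ → ℕ)
    (c : {c : VisscherCell ι κ // visscherDegree c = 0 + 1})
    (e : {c : VisscherCell ι κ // visscherDegree c = 0}) :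
    cellularDifferential k visscherDegree visscherSign (visscherLabel ω) 0 (Finsupp.single c 1) =
      Finsupp.single e (monomial (visscherLabel ω c) 1) := by
  have := subsingleton_visscherDegree_eq_zero (ι := ι) (κ := κ)
  have h0 := degree_eq_zero_iff.1 e.2
  have hlabel : visscherLabel ω e = 0 := by
    simp [visscherLabel, h0, bot_eq_zero]
  rw [cellularDifferential, Finsupp.linearCombination_single, one_smul,
    Fintype.sum_subsingleton _ e, visscherSign_of_empty h0, hlabel, tsub_zero, Int.cast_one]

theorem exact_visscherAugmentation (ω : ι → κ → ℕ) :
    Function.Exact (cellularDifferential k visscherDegree visscherSign (visscherLabel ω) 0)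
      (cellularAugmentation k (visscherDegree (ι := ι) (κ := κ)) (weightedEdgeIdeal k ω)) := by
  have := subsingleton_visscherDegree_eq_zero (ι := ι) (κ := κ)
  let e : {c : VisscherCell ι κ // visscherDegree c = 0} := ⟨⟨(∅, ∅), by simp⟩, by
    simp [visscherDegree]⟩
  rw [LinearMap.exact_iff]
  apply le_antisymm
  · intro z hz
    have hz' : z = Finsupp.single e (z e) := by
      refine Finsupp.ext fun e' => ?_
      rw [Subsingleton.elim e' e, Finsupp.single_eq_same]
    rw [LinearMap.mem_ker, hz', cellularAugmentation_single, Ideal.Quotient.eq_zero_iff_mem] at hz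
    have hle : weightedEdgeIdeal k ω ≤ (LinearMap.range (cellularDifferential k visscherDegree
        visscherSign (visscherLabel ω) 0)).comap (Finsupp.lsingle e) := by
      rw [weightedEdgeIdeal, Ideal.span_le]
      rintro _ ⟨p, rfl⟩
      refine ⟨Finsupp.single ⟨edgeCell p.1 p.2, visscherDegree_edgeCell p.1 p.2⟩ 1, ?_⟩
      rw [cellularDifferential_visscher_single k ω _ e]
      simp only [Finsupp.lsingle_apply]
      rw [visscherLabel_edgeCell, monomial_edgeExponent]
    rw [hz']
    exact hle hz
  · rw [cellularDifferential, Finsupp.range_linearCombination, Submodule.span_le]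
    rintro _ ⟨c, rfl⟩
    have h := cellularDifferential_visscher_single k ω c e
    rw [cellularDifferential, Finsupp.linearCombination_single, one_smul] at h
    simp only
    rw [h, SetLike.mem_coe, LinearMap.mem_ker, cellularAugmentation_single,
      Ideal.Quotient.eq_zero_iff_mem]
    obtain ⟨i, j, h⟩ := exists_eq_edgeCell c.2
    rw [h, visscherLabel_edgeCell, monomial_edgeExponent]
    exact Ideal.subset_span ⟨(i, j), rfl⟩

/-- Visscher's complex is a resolution if and only if, for all exponents `a` of the `X_i` and `b` of
the `Y_j`, the complex of bicliques of the graph of the edges whose monomial divides `X^a Y^b` is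
acyclic. -/
theorem visscherResolves_iff [Nonempty ι] [Nonempty κ] {ω : ι → κ → ℕ} (hω : ∀ i j, 0 < ω i j) :
    VisscherResolves k ω ↔ ∀ (a : ι → ℕ) (b : κ → ℕ),
      AcyclicOn visscherDegree (fun c c' => ((visscherSign c c' : ℤ) : k))
        (IsBiclique fun i j => ω i j ≤ a i ∧ ω i j ≤ b j) := by
  have hstrand : (∀ d, Function.Exact
      (cellularDifferential k (visscherDegree (ι := ι) (κ := κ)) visscherSign (visscherLabel ω)
        (d + 1))
      (cellularDifferential k visscherDegree visscherSign (visscherLabel ω) d)) ↔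
      ∀ (a : ι → ℕ) (b : κ → ℕ),
      AcyclicOn visscherDegree (fun c c' => ((visscherSign c c' : ℤ) : k))
        (IsBiclique fun i j => ω i j ≤ a i ∧ ω i j ≤ b j) := by
    rw [exact_cellularDifferential_iff
      (fun c c' _ h => visscherLabel_mono ω (visscherSign_le fun h0 => h (by simp [h0])))
      (squaresToZero_visscherSign k)]
    have hP : ∀ u : ι ⊕ κ →₀ ℕ, (fun c => visscherLabel ω c ≤ u) =
        IsBiclique fun i j => ω i j ≤ u (Sum.inl i) ∧ ω i j ≤ u (Sum.inr j) := by
      intro u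
      funext c
      simp only [visscherLabel_le_iff, edgeExponent_le_iff, IsBiclique]
    constructor
    · intro H a b
      have := H (Finsupp.equivFunOnFinite.symm (Sum.elim a b))
      rw [hP] at this
      simpa using this
    · intro H u
      rw [hP]
      exact H _ _
  rw [← hstrand]
  exact ⟨fun h => h.exact, fun h =>
    { regular := isFiniteRegularCellComplex_visscher
      incidence := isIncidenceFunction_visscherSign
      labelling := isMonomialLabelling_visscherLabel ω
      minimal := range_visscherDifferential_le k hω
      exact := h
      exact_augmentation := exact_visscherAugmentation k ω
      surjective_augmentation := surjective_visscherAugmentation k _ }⟩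

end Resolution

/-! ### Complexes of bicliques -/

section Bicliques

open Finset VisscherCell

variable {ι κ : Type*}

theorem IsBiclique.mono {G : ι → κ → Prop} {c c' : VisscherCell ι κ} (h : IsBiclique G c)
    (hle : c' ≤ c) : IsBiclique G c' :=
  fun i hi j hj => h i (hle.1 hi) j (hle.2 hj)

/-- The cell obtained from a nonempty cell by adding `v` to its first entry. -/
def insertLeft [DecidableEq ι] (v : ι) (c : VisscherCell ι κ) : VisscherCell ι κ :=
  if h : c.1.1.Nonempty then
    ⟨(insert v c.1.1, c.1.2), iff_of_false (insert_ne_empty _ _) (right_nonempty_iff.2 h).ne_empty⟩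
  else c

theorem insertLeft_val [DecidableEq ι] (v : ι) {c : VisscherCell ι κ} (h : c.1.1.Nonempty) :
    (insertLeft v c).1 = (insert v c.1.1, c.1.2) := by
  rw [insertLeft, dif_pos h]

/-- The cell `({v}, B ∪ {j})`. -/
def insertRight [DecidableEq κ] (v : ι) (j : κ) (c : VisscherCell ι κ) : VisscherCell ι κ :=
  ⟨({v}, insert j c.1.2), by simp⟩

variable [LinearOrder ι] [LinearOrder κ] {k : Type*} [Field k]

theorem visscherSign_cast_ne_zero_iff {c c' : VisscherCell ι κ}
    (hd : visscherDegree c = visscherDegree c' + 1) :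
    ((visscherSign c c' : ℤ) : k) ≠ 0 ↔ c' ≤ c := by
  refine ⟨fun h => visscherSign_le fun h0 => h (by simp [h0]), fun h => ?_⟩
  rcases visscherSign_eq_one_or_neg_one h hd with h | h <;> simp [h]

variable [Fintype ι] [Fintype κ]

/-- If `v` is adjacent in `G` to every vertex of the second partite set that is not isolated, then
the complex of bicliques of `G` is acyclic: it collapses onto the cells `({v}, B)`, which form a
full simplex. -/
theorem acyclicOn_isBiclique_of_dominating {ε : VisscherCell ι κ → VisscherCell ι κ → k}
    (hsq : SquaresToZero visscherDegree ε)
    (hε : ∀ c c', visscherDegree c = visscherDegree c' + 1 → (ε c c' ≠ 0 ↔ c' ≤ c))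
    {G : ι → κ → Prop} {v : ι} (hv : ∀ i j, G i j → G v j) :
    AcyclicOn visscherDegree ε (IsBiclique G) := by
  intro d g hg hcycle
  by_cases hG : ∃ i j, G i j
  swap
  · have hg0 : g = 0 := by
      funext c
      by_contra h0
      obtain ⟨hd, hP⟩ := hg c h0
      obtain ⟨i, hi⟩ := degree_pos_iff.1 (show 0 < visscherDegree c by omega)
      obtain ⟨j, hj⟩ := right_nonempty_iff.2 ⟨i, hi⟩
      exact hG ⟨i, j, hP i hi j hj⟩
    exact ⟨0, by simp, by simp [hg0]⟩
  obtain ⟨i₀, j₀, hij₀⟩ := hG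
  have hvj := hv i₀ j₀ hij₀
  -- Match `(A, B)` with `(A ∪ {v}, B)`.
  obtain ⟨h₁, g₁, hh₁, hg₁, hcycle₁, hgg₁⟩ := hsq.exists_matching_reduction
    (R := IsBiclique G) (Q := fun c => c.1.1.Nonempty ∧ v ∉ c.1.1) (insertLeft v)
    (by
      rintro c hR ⟨hne, hvc⟩
      have hval := insertLeft_val v hne
      refine ⟨?_, ?_, ?_⟩
      · intro i hi j hj
        rw [hval] at hi hj
        rcases mem_insert.1 hi with rfl | hi
        · obtain ⟨i', hi'⟩ := hne
          exact hv i' j (hR i' hi' j hj)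
        · exact hR i hi j hj
      · simp [hval]
      · have := hne.card_pos
        simp only [visscherDegree, hval, card_insert_of_notMem hvc]
        omega)
    (by
      rintro c c' - ⟨hne, hvc⟩ - ⟨hne', hvc'⟩ heq
      have h := congrArg Subtype.val heq
      rw [insertLeft_val v hne, insertLeft_val v hne', Prod.ext_iff] at h
      refine Subtype.ext (Prod.ext ?_ h.2)
      rw [← erase_insert hvc, ← erase_insert hvc']
      exact congrArg (fun s => s.erase v) h.1)
    (by
      rintro c c' - - ⟨hne, hvc⟩ hQ' hd
      have hval := insertLeft_val v hne
      have hne' : c'.1.1.Nonempty := degree_pos_iff.1 (by omega)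
      have hvc' : v ∈ c'.1.1 := by_contra fun h => hQ' ⟨hne', h⟩
      rw [hε c' c hd]
      constructor
      · intro hle
        refine (eq_of_le_of_degree_le ⟨?_, ?_⟩ ?_).symm
        · rw [hval]
          exact insert_subset hvc' hle.1
        · rw [hval]
          exact hle.2
        · have := hne.card_pos
          rw [hd]
          simp only [visscherDegree, hval, card_insert_of_notMem hvc]
          omega
      · rintro rfl
        rw [le_iff, hval]
        exact ⟨subset_insert _ _, Subset.rfl⟩)
    (fun c c' hR hd h0 => hR.mono ((hε c c' hd).1 h0)) hg hcycle
  -- What remains is supported on the cells `({v}, B)`.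
  have hg₁v : ∀ c, g₁ c ≠ 0 → visscherDegree c = d + 1 ∧ IsBiclique G c ∧ c.1.1 ⊆ {v} := by
    intro c hc
    obtain ⟨hd, hR, hQ, ht⟩ := hg₁ c hc
    refine ⟨hd, hR, ?_⟩
    have hne : c.1.1.Nonempty := degree_pos_iff.1 (by omega)
    have hvc : v ∈ c.1.1 := by_contra fun h => hQ ⟨hne, h⟩
    by_contra hsub
    have hne₀ : (c.1.1.erase v).Nonempty := by
      obtain ⟨i, hi, hiv⟩ := Finset.not_subset.1 hsub
      exact ⟨i, mem_erase.2 ⟨by simpa using hiv, hi⟩⟩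
    let c₀ : VisscherCell ι κ := ⟨(c.1.1.erase v, c.1.2),
      iff_of_false hne₀.ne_empty (right_nonempty_iff.2 hne).ne_empty⟩
    have hle : c₀ ≤ c := ⟨erase_subset _ _, Subset.rfl⟩
    refine ht c₀ (hR.mono hle) ⟨hne₀, by simp [c₀]⟩ (Subtype.ext ?_)
    rw [insertLeft_val v (show c₀.1.1.Nonempty from hne₀)]
    exact Prod.ext (insert_erase hvc).symm rfl
  -- Match `({v}, B)` with `({v}, B ∪ {j₀})`, and the empty cell with `({v}, {j₀})`.
  obtain ⟨h₂, g₂, hh₂, hg₂, -, hgg₂⟩ := hsq.exists_matching_reduction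
    (R := fun c => IsBiclique G c ∧ c.1.1 ⊆ {v}) (Q := fun c => j₀ ∉ c.1.2) (insertRight v j₀)
    (by
      rintro c ⟨hR, hsub⟩ hj
      refine ⟨⟨?_, Subset.rfl⟩, ?_, ?_⟩
      · intro i hi j hj
        rw [mem_singleton.1 hi]
        rcases mem_insert.1 hj with rfl | hj
        · exact hvj
        · obtain ⟨i', hi'⟩ := right_nonempty_iff.1 ⟨j, hj⟩
          exact hv i' j (hR i' hi' j hj)
      · simp [insertRight]
      · simp only [visscherDegree, insertRight, card_insert_of_notMem hj, card_singleton]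
        rcases c.1.1.eq_empty_or_nonempty with h0 | h0
        · simp [h0, c.2.1 h0]
        · have := h0.card_pos
          have := card_le_card hsub
          rw [card_singleton] at this
          omega)
    (by
      rintro c c' ⟨-, hc⟩ hj ⟨-, hc'⟩ hj' heq
      have h2 : c.1.2 = c'.1.2 := by
        rw [← erase_insert hj, ← erase_insert hj']
        exact congrArg (fun c : VisscherCell ι κ => c.1.2.erase j₀) heq
      refine Subtype.ext (Prod.ext ?_ h2)
      rcases c.1.1.eq_empty_or_nonempty with h0 | h0
      · rw [h0, c'.2.2 (h2 ▸ c.2.1 h0)]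
      · have h0' : c'.1.1.Nonempty := by
          rw [← right_nonempty_iff] at h0 ⊢
          rwa [← h2]
        rw [(Finset.Nonempty.subset_singleton_iff h0).1 hc,
          (Finset.Nonempty.subset_singleton_iff h0').1 hc'])
    (by
      rintro c c' ⟨-, hc⟩ ⟨-, hc'⟩ hj hj' hd
      rw [not_not] at hj'
      have hne' : c'.1.1.Nonempty := degree_pos_iff.1 (by omega)
      have hc'v := (Finset.Nonempty.subset_singleton_iff hne').1 hc'
      rw [hε c' c hd]
      constructor
      · intro hle
        have hd' := degree_add_one hne'
        rw [hc'v, card_singleton] at hd'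
        have hsub : insert j₀ c.1.2 ⊆ c'.1.2 := insert_subset hj' hle.2
        refine Subtype.ext (Prod.ext hc'v (Finset.eq_of_subset_of_card_le hsub ?_).symm)
        rw [card_insert_of_notMem hj]
        rcases c.1.1.eq_empty_or_nonempty with h0 | h0
        · have := degree_eq_zero_iff.2 h0
          omega
        · have h1 := degree_add_one h0
          rw [(Finset.Nonempty.subset_singleton_iff h0).1 hc, card_singleton] at h1
          omega
      · rintro rfl
        exact ⟨hc, subset_insert _ _⟩)
    (fun c c' hR hd h0 => by
      have hle := (hε c c' hd).1 h0
      exact ⟨hR.1.mono hle, hle.1.trans hR.2⟩) hg₁v hcycle₁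
  have hg₂0 : ∀ c, g₂ c = 0 := by
    intro c
    by_contra h0
    obtain ⟨hd, ⟨hR, hsub⟩, hQ, ht⟩ := hg₂ c h0
    rw [not_not] at hQ
    have hne : c.1.1.Nonempty := degree_pos_iff.1 (by omega)
    have hcv := (Finset.Nonempty.subset_singleton_iff hne).1 hsub
    rcases (c.1.2.erase j₀).eq_empty_or_nonempty with h1 | h1
    · refine ht ⟨(∅, ∅), by simp⟩ ⟨by simp [IsBiclique], by simp⟩ (by simp)
        (Subtype.ext (Prod.ext hcv ?_))
      rw [← insert_erase hQ, h1]
      rfl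
    · let c₀ : VisscherCell ι κ := ⟨({v}, c.1.2.erase j₀),
        iff_of_false (singleton_ne_empty v) h1.ne_empty⟩
      have hle : c₀ ≤ c := ⟨hcv.symm.subset, erase_subset _ _⟩
      exact ht c₀ ⟨hR.mono hle, Subset.rfl⟩ (by simp [c₀])
        (Subtype.ext (Prod.ext hcv (insert_erase hQ).symm))
  refine ⟨h₁ + h₂, fun c hc => ?_, fun e he => ?_⟩
  · by_cases h0 : h₁ c = 0
    · have h0' : h₂ c ≠ 0 := by simpa [h0] using hc
      exact ⟨(hh₂ c h0').1, (hh₂ c h0').2.1⟩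
    · exact hh₁ c h0
  · rw [hgg₁ e he, hgg₂ e he, hg₂0 e, zero_add, add_comm, ← Finset.sum_add_distrib]
    exact Finset.sum_congr rfl fun c _ => by rw [Pi.add_apply, add_mul]

theorem acyclicOn_isBiclique_of_dominating_left {G : ι → κ → Prop} {v : ι}
    (hv : ∀ i j, G i j → G v j) :
    AcyclicOn visscherDegree (fun c c' => ((visscherSign c c' : ℤ) : k)) (IsBiclique G) :=
  acyclicOn_isBiclique_of_dominating (squaresToZero_visscherSign k)
    (fun _ _ hd => visscherSign_cast_ne_zero_iff hd) hv

/-- Exchanging the two partite sets. -/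
def visscherSwap (ι κ : Type*) : VisscherCell κ ι ≃ VisscherCell ι κ where
  toFun c := ⟨(c.1.2, c.1.1), c.2.symm⟩
  invFun c := ⟨(c.1.2, c.1.1), c.2.symm⟩
  left_inv _ := rfl
  right_inv _ := rfl

theorem acyclicOn_isBiclique_of_dominating_right {G : ι → κ → Prop} {v : κ}
    (hv : ∀ i j, G i j → G i v) :
    AcyclicOn visscherDegree (fun c c' => ((visscherSign c c' : ℤ) : k)) (IsBiclique G) := by
  have hdeg : ∀ c, visscherDegree (visscherSwap ι κ c) = visscherDegree c := fun c => by
    simp [visscherDegree, visscherSwap, add_comm]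
  have hle : ∀ c c', visscherSwap ι κ c' ≤ visscherSwap ι κ c ↔ c' ≤ c := fun c c' => and_comm
  rw [← acyclicOn_comp_iff (visscherSwap ι κ) (visscherSwap ι κ).injective hdeg
    (ε' := fun c c' => ((visscherSign (visscherSwap ι κ c) (visscherSwap ι κ c') : ℤ) : k))
    (fun _ _ => rfl) (fun c _ => (visscherSwap ι κ).surjective c)
    (fun c c' h hd h0 => h.mono ((visscherSign_cast_ne_zero_iff hd).1 h0))]
  have hP : (fun c => IsBiclique G (visscherSwap ι κ c)) = IsBiclique fun j i => G i j := by
    funext c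
    exact propext ⟨fun h j hj i hi => h i hi j hj, fun h i hi j hj => h j hj i hi⟩
  rw [hP]
  refine acyclicOn_isBiclique_of_dominating (fun c e hd => ?_) (fun c c' hd => ?_)
    (fun j i h => hv i j h)
  · refine Eq.trans ?_ (squaresToZero_visscherSign k (visscherSwap ι κ c) (visscherSwap ι κ e)
      (by rw [hdeg, hdeg, hd]))
    rw [← (visscherSwap ι κ).sum_comp]
    simp only [hdeg]
  · rw [visscherSign_cast_ne_zero_iff (by rw [hdeg, hdeg, hd]), hle]

/-- If an edge of `G` is a connected component of `G` and `G` has another edge, then the complex of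
bicliques of `G` is disconnected. -/
theorem not_acyclicOn_isBiclique_of_isolated_edge {G : ι → κ → Prop} {i i' : ι} {j j' : κ}
    (hij : G i j) (hi : ∀ b, G i b → b = j) (hj : ∀ a, G a j → a = i) (hij' : G i' j')
    (hne : i' ≠ i) :
    ¬ AcyclicOn visscherDegree (fun c c' => ((visscherSign c c' : ℤ) : k)) (IsBiclique G) := by
  intro H
  have hne' : edgeCell i' j' ≠ edgeCell i j := fun h =>
    hne (by simpa [edgeCell] using congrArg (fun c : VisscherCell ι κ => c.1.1) h)
  -- The difference of the vertices of the two edges is a cycle that does not bound.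
  obtain ⟨h, hh, hbd⟩ := H 0
    (fun c => if c = edgeCell i j then 1 else if c = edgeCell i' j' then -1 else 0)
    (fun c hc => by
      by_cases h1 : c = edgeCell i j
      · exact ⟨by rw [h1, visscherDegree_edgeCell], by simpa [h1, IsBiclique, edgeCell] using hij⟩
      by_cases h2 : c = edgeCell i' j'
      · exact ⟨by rw [h2, visscherDegree_edgeCell], by simpa [h2, IsBiclique, edgeCell] using hij'⟩
      simp [h1, h2] at hc)
    (fun e he => by
      rw [← Finset.sum_subset (subset_univ {edgeCell i j, edgeCell i' j'}),
        Finset.sum_pair hne'.symm]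
      · simp [hne', visscherSign_of_empty (degree_eq_zero_iff.1 he)]
      · intro c _ hc
        simp only [mem_insert, mem_singleton, not_or] at hc
        simp [hc.1, hc.2])
  have h1 := hbd (edgeCell i j) (visscherDegree_edgeCell i j)
  rw [if_pos rfl] at h1
  obtain ⟨c, -, hc⟩ := Finset.exists_ne_zero_of_sum_ne_zero (h1.trans_ne one_ne_zero)
  obtain ⟨hd, hG⟩ := hh c (left_ne_zero_of_mul hc)
  have hle := (visscherSign_cast_ne_zero_iff (by rw [hd, visscherDegree_edgeCell])).1
    (right_ne_zero_of_mul hc)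
  obtain ⟨hic, hjc⟩ := edgeCell_le_iff.1 hle
  have hle' : c ≤ edgeCell i j := by
    refine ⟨fun a ha => ?_, fun b hb => ?_⟩
    · exact mem_singleton.2 (hj a (hG a ha j hjc))
    · exact mem_singleton.2 (hi b (hG i hic b hb))
  have := degree_le_degree hle'
  rw [hd, visscherDegree_edgeCell] at this
  omega

end Bicliques

/-! ### Deleting isolated vertices -/

section Restriction

open Finset VisscherCell

variable {ι κ ι' κ' : Type*} [LinearOrder ι] [LinearOrder κ] [LinearOrder ι'] [LinearOrder κ']

/-- The map on cells induced by order embeddings of the vertex sets. -/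
def visscherMap (f : ι' ↪o ι) (g : κ' ↪o κ) (c : VisscherCell ι' κ') : VisscherCell ι κ :=
  ⟨(c.1.1.map f.toEmbedding, c.1.2.map g.toEmbedding), by simpa using c.2⟩

theorem visscherMap_injective (f : ι' ↪o ι) (g : κ' ↪o κ) :
    Function.Injective (visscherMap f g) := by
  intro c c' h
  have h1 := congrArg (fun c : VisscherCell ι κ => c.1.1) h
  have h2 := congrArg (fun c : VisscherCell ι κ => c.1.2) h
  exact Subtype.ext (Prod.ext (Finset.map_injective _ h1) (Finset.map_injective _ h2))

theorem visscherDegree_visscherMap (f : ι' ↪o ι) (g : κ' ↪o κ) (c : VisscherCell ι' κ') :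
    visscherDegree (visscherMap f g c) = visscherDegree c := by
  simp [visscherDegree, visscherMap]

theorem visscherSign_visscherMap (f : ι' ↪o ι) (g : κ' ↪o κ) (c c' : VisscherCell ι' κ') :
    visscherSign (visscherMap f g c) (visscherMap f g c') = visscherSign c c' := by
  have hA : ∀ a, #{x ∈ c.1.1.map f.toEmbedding | x < f a} = #{x ∈ c.1.1 | x < a} := by
    intro a
    rw [Finset.filter_map, card_map]
    simp
  have hB : ∀ b, #{x ∈ c.1.2.map g.toEmbedding | x < g b} = #{x ∈ c.1.2 | x < b} := by
    intro b
    rw [Finset.filter_map, card_map]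
    simp
  have hl : ∀ a, (c'.1.1.map f.toEmbedding, c'.1.2.map g.toEmbedding) =
      ((c.1.1.map f.toEmbedding).erase (f a), c.1.2.map g.toEmbedding) ↔
        c'.1 = (c.1.1.erase a, c.1.2) := by
    intro a
    rw [show f a = f.toEmbedding a from rfl, ← Finset.map_erase, Prod.ext_iff, Prod.ext_iff]
    simp only [Finset.map_inj]
  have hr : ∀ b, (c'.1.1.map f.toEmbedding, c'.1.2.map g.toEmbedding) =
      (c.1.1.map f.toEmbedding, (c.1.2.map g.toEmbedding).erase (g b)) ↔
        c'.1 = (c.1.1, c.1.2.erase b) := by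
    intro b
    rw [show g b = g.toEmbedding b from rfl, ← Finset.map_erase, Prod.ext_iff, Prod.ext_iff]
    simp only [Finset.map_inj]
  simp only [visscherSign, visscherMap, sum_map, RelEmbedding.coe_toEmbedding, hl, hr, hA, hB,
    card_map, map_eq_empty]

variable [Fintype ι] [Fintype κ] [Fintype ι'] [Fintype κ'] {k : Type*} [Field k]

/-- The complex of bicliques of a graph does not change when isolated vertices are deleted. -/
theorem acyclicOn_isBiclique_restrict_iff (f : ι' ↪o ι) (g : κ' ↪o κ) {G : ι → κ → Prop}
    (hG : ∀ i j, G i j → i ∈ Set.range f ∧ j ∈ Set.range g) :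
    AcyclicOn visscherDegree (fun c c' => ((visscherSign c c' : ℤ) : k))
        (IsBiclique fun i j => G (f i) (g j)) ↔
      AcyclicOn visscherDegree (fun c c' => ((visscherSign c c' : ℤ) : k)) (IsBiclique G) := by
  rw [← acyclicOn_comp_iff (visscherMap f g) (visscherMap_injective f g)
    (visscherDegree_visscherMap f g) (ε' := fun c c' => ((visscherSign c c' : ℤ) : k))
    (fun c c' => by rw [visscherSign_visscherMap]) (fun c hc => ?_)
    (fun c c' h hd h0 => h.mono ((visscherSign_cast_ne_zero_iff hd).1 h0))]
  · have hP : (fun c => IsBiclique G (visscherMap f g c)) =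
        IsBiclique fun i j => G (f i) (g j) := by
      funext c
      simp [IsBiclique, visscherMap]
    rw [hP]
  · have hA : ∀ a ∈ c.1.1, a ∈ Set.range f := fun a ha => by
      obtain ⟨b, hb⟩ := right_nonempty_iff.2 ⟨a, ha⟩
      exact (hG a b (hc a ha b hb)).1
    have hB : ∀ b ∈ c.1.2, b ∈ Set.range g := fun b hb => by
      obtain ⟨a, ha⟩ := right_nonempty_iff.1 ⟨b, hb⟩
      exact (hG a b (hc a ha b hb)).2
    have hA' : (c.1.1.preimage f f.injective.injOn).map f.toEmbedding = c.1.1 := by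
      ext a
      simp only [mem_map, mem_preimage, RelEmbedding.coe_toEmbedding]
      refine ⟨fun ⟨x, hx, hxa⟩ => hxa ▸ hx, fun ha => ?_⟩
      obtain ⟨x, rfl⟩ := hA a ha
      exact ⟨x, ha, rfl⟩
    have hB' : (c.1.2.preimage g g.injective.injOn).map g.toEmbedding = c.1.2 := by
      ext b
      simp only [mem_map, mem_preimage, RelEmbedding.coe_toEmbedding]
      refine ⟨fun ⟨x, hx, hxb⟩ => hxb ▸ hx, fun hb => ?_⟩
      obtain ⟨x, rfl⟩ := hB b hb
      exact ⟨x, hb, rfl⟩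
    refine ⟨⟨(c.1.1.preimage f f.injective.injOn, c.1.2.preimage g g.injective.injOn), ?_⟩,
      Subtype.ext (Prod.ext hA' hB')⟩
    rw [← Finset.map_eq_empty (f := f.toEmbedding), hA', ← Finset.map_eq_empty (f := g.toEmbedding),
      hB']
    exact c.2

end Restriction

/-! ### Deleting a vertex of minimal weight -/

section Main

open Finset VisscherCell

theorem Function.mem_range_of_extend_pos {α β : Type*} {e : α → β} {u : α → ℕ} {x : β}
    (hx : 0 < Function.extend e u 0 x) : x ∈ Set.range e := by
  by_contra h
  rw [Function.extend_apply' _ _ _ h] at hx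
  exact lt_irrefl 0 hx

variable {ι κ : Type*} [Fintype ι] [Fintype κ] [LinearOrder ι] [LinearOrder κ]
  {k : Type*} [Field k] {ω : ι → κ → ℕ}

/-- Visscher's construction resolves the edge ideal of every induced complete bipartite subgraph
if it resolves that of the whole graph. -/
theorem VisscherResolves.restrict {ι' κ' : Type*} [Fintype ι'] [Fintype κ'] [LinearOrder ι']
    [LinearOrder κ'] [Nonempty ι'] [Nonempty κ'] (hω : ∀ i j, 0 < ω i j)
    (h : VisscherResolves k ω) (f : ι' ↪o ι) (g : κ' ↪o κ) :
    VisscherResolves k fun i j => ω (f i) (g j) := by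
  have : Nonempty ι := Nonempty.map f inferInstance
  have : Nonempty κ := Nonempty.map g inferInstance
  rw [visscherResolves_iff k hω] at h
  rw [visscherResolves_iff k fun i j => hω _ _]
  intro a b
  -- Exponent `0` at the other vertices makes them isolated.
  have := (acyclicOn_isBiclique_restrict_iff (k := k) f g (G := fun i j =>
    ω i j ≤ Function.extend f a 0 i ∧ ω i j ≤ Function.extend g b 0 j) fun i j hij =>
      ⟨Function.mem_range_of_extend_pos ((hω i j).trans_le hij.1),
        Function.mem_range_of_extend_pos ((hω i j).trans_le hij.2)⟩).2 (h _ _)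
  simpa [f.injective.extend_apply, g.injective.extend_apply] using this

theorem visscherResolves_of_delete_left [Nonempty κ] (hω : ∀ i j, 0 < ω i j) {v : ι}
    [Nonempty {i // i ≠ v}] (hv : ∀ i j j', ω v j ≤ ω i j')
    (h : VisscherResolves k fun (i : {i // i ≠ v}) j => ω i j) : VisscherResolves k ω := by
  have : Nonempty ι := ⟨v⟩
  rw [visscherResolves_iff k fun _ _ => hω _ _] at h ⊢
  intro a b
  by_cases hdom : ∀ j, ω v j ≤ a v
  · -- Non-isolated vertices of the other side have exponent at least the minimal weight.
    exact acyclicOn_isBiclique_of_dominating_left (v := v) fun i j hij =>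
      ⟨hdom j, (hv i j j).trans hij.2⟩
  · -- The exponent at `v` is below the minimal weight, so `v` is isolated.
    obtain ⟨j₀, hj₀⟩ := not_forall.1 hdom
    refine (acyclicOn_isBiclique_restrict_iff (OrderEmbedding.subtype (· ≠ v))
      (RelEmbedding.refl _) fun i j hij => ⟨⟨⟨i, ?_⟩, rfl⟩, ⟨j, rfl⟩⟩).1 (h (fun i => a i) b)
    rintro rfl
    exact hj₀ ((hv i j₀ j).trans hij.1)

theorem visscherResolves_of_delete_right [Nonempty ι] (hω : ∀ i j, 0 < ω i j) {v : κ}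
    [Nonempty {j // j ≠ v}] (hv : ∀ i i' j, ω i v ≤ ω i' j)
    (h : VisscherResolves k fun i (j : {j // j ≠ v}) => ω i j) : VisscherResolves k ω := by
  have : Nonempty κ := ⟨v⟩
  rw [visscherResolves_iff k fun _ _ => hω _ _] at h ⊢
  intro a b
  by_cases hdom : ∀ i, ω i v ≤ b v
  · exact acyclicOn_isBiclique_of_dominating_right (v := v) fun i j hij =>
      ⟨(hv i i j).trans hij.1, hdom i⟩
  · obtain ⟨i₀, hi₀⟩ := not_forall.1 hdom
    refine (acyclicOn_isBiclique_restrict_iff (RelEmbedding.refl _)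
      (OrderEmbedding.subtype (· ≠ v)) fun i j hij => ⟨⟨i, rfl⟩, ⟨⟨j, ?_⟩, rfl⟩⟩).1
      (h a fun j => b j)
    rintro rfl
    exact hi₀ ((hv i₀ i j).trans hij.2)

/-- An edge of minimal weight has an endpoint all of whose edges have minimal weight: otherwise
there are `i'`, `j'` for which the edges of weight bounded by the exponents of the least common
multiple of the monomials of `i j` and `i' j'` are just these two disjoint edges. -/
theorem VisscherResolves.forall_eq_or_forall_eq [Nonempty ι] [Nonempty κ]
    (hω : ∀ i j, 0 < ω i j) (h : VisscherResolves k ω) {i : ι} {j : κ}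
    (hmin : ∀ i' j', ω i j ≤ ω i' j') : (∀ b, ω i b = ω i j) ∨ ∀ a, ω a j = ω i j := by
  by_contra! hcon
  obtain ⟨⟨j', hj'⟩, i', hi'⟩ := hcon
  have hi'i : i' ≠ i := by rintro rfl; exact hi' rfl
  have hj'j : j' ≠ j := by rintro rfl; exact hj' rfl
  have h1 : ω i j < ω i j' := lt_of_le_of_ne (hmin _ _) hj'.symm
  have h2 : ω i j < ω i' j := lt_of_le_of_ne (hmin _ _) hi'.symm
  rw [visscherResolves_iff k hω] at h
  refine not_acyclicOn_isBiclique_of_isolated_edge (k := k) (i := i) (i' := i') (j := j) (j' := j')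
    ?_ ?_ ?_ ?_ hi'i (h (fun a => if a = i then ω i j else if a = i' then ω i' j' else 0)
      (fun b => if b = j then ω i j else if b = j' then ω i' j' else 0))
  · simp
  · rintro b ⟨hb1, hb2⟩
    by_contra hbj
    have := hω i b
    by_cases hbj' : b = j'
    · subst hbj'
      simp at hb1
      omega
    · simp [hbj, hbj'] at hb2
      omega
  · rintro a ⟨ha1, ha2⟩
    by_contra hai
    have := hω a j
    by_cases hai' : a = i'
    · subst hai'
      simp at ha2
      omega
    · simp [hai, hai'] at ha1
      omega
  · simp [hi'i, hj'j]

end Main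

theorem theorem1p6 (k : Type*) [Field k] (m n : ℕ) (hm : 1 ≤ m) (hn : 1 ≤ n)
    (ω : Fin m → Fin n → ℕ) (hω : ∀ i j, 0 < ω i j)
    (α : ℕ) (hα : IsLeast (Set.range fun p : Fin m × Fin n => ω p.1 p.2) α) :
    VisscherResolves k ω ↔
      (m = 1 ∨ n = 1) ∨
      (2 ≤ m ∧ 2 ≤ n ∧
        ((∃ v : Fin m, (∀ j, ω v j = α) ∧
            VisscherResolves k (fun (i : {i : Fin m // i ≠ v}) (j : Fin n) => ω i j)) ∨
          (∃ v : Fin n, (∀ i, ω i v = α) ∧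
            VisscherResolves k (fun (i : Fin m) (j : {j : Fin n // j ≠ v}) => ω i j)))) := by
  have : Nonempty (Fin m) := ⟨⟨0, hm⟩⟩
  have : Nonempty (Fin n) := ⟨⟨0, hn⟩⟩
  have hmin : ∀ i j, α ≤ ω i j := fun i j => hα.2 ⟨(i, j), rfl⟩
  have hdel : ∀ {l : ℕ}, 2 ≤ l → ∀ v : Fin l, Nonempty {i // i ≠ v} := fun hl v => by
    have : Nontrivial (Fin _) := Fin.nontrivial_iff_two_le.2 hl
    exact (exists_ne v).elim fun i hi => ⟨⟨i, hi⟩⟩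
  constructor
  · intro h
    rcases (by omega : (m = 1 ∨ n = 1) ∨ 2 ≤ m ∧ 2 ≤ n) with h1 | ⟨hm2, hn2⟩
    · exact Or.inl h1
    obtain ⟨⟨i, j⟩, hij⟩ := hα.1
    refine Or.inr ⟨hm2, hn2, ?_⟩
    rcases h.forall_eq_or_forall_eq hω (i := i) (j := j)
      (fun i' j' => hij.trans_le (hmin i' j')) with hi | hj
    · have := hdel hm2 i
      exact Or.inl ⟨i, fun b => (hi b).trans hij,
        h.restrict hω (OrderEmbedding.subtype (· ≠ i)) (RelEmbedding.refl _)⟩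
    · have := hdel hn2 j
      exact Or.inr ⟨j, fun a => (hj a).trans hij,
        h.restrict hω (RelEmbedding.refl _) (OrderEmbedding.subtype (· ≠ j))⟩
  · rintro ((rfl | rfl) | ⟨hm2, hn2, ⟨v, hv, h⟩ | ⟨v, hv, h⟩⟩)
    · rw [visscherResolves_iff k hω]
      exact fun a b => acyclicOn_isBiclique_of_dominating_left (v := 0) fun i j hij => by
        rwa [← Subsingleton.elim i 0]
    · rw [visscherResolves_iff k hω]
      exact fun a b => acyclicOn_isBiclique_of_dominating_right (v := 0) fun i j hij => by
        rwa [← Subsingleton.elim j 0]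
    · have := hdel hm2 v
      exact visscherResolves_of_delete_left hω (fun i j j' => (hv j).trans_le (hmin i j')) h
    · have := hdel hn2 v
      exact visscherResolves_of_delete_right hω (fun i i' j => (hv i).trans_le (hmin i' j)) h
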